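/- **Setting.** Let $\mathcal S,\mathcal A$ be finite sets and $H,K\ge1$ integers, $T=HK$. A constrained MDP has transition kernels $\mathbb P_h(\cdot\mid x,a)$ on $\mathcal S$, deterministic reward and utility functions $r_h,g_h:\mathcal S\times\mathcal A\to[0,1]$ ($h=1,\dots,H$), a fixed initial state $x_1$ and an offset $b\in(0,H]$. For a Markov policy $\pi=\{\pi_h(\cdot\mid x)\}$ and $\diamond\in\{r,g\}$ let $V^\pi_{\diamond,1}(x_1)=\mathbb E_\pi\big[\sum_{h=1}^H\diamond_h(x_h,a_h)\big]$, and let $\pi^\star$ maximize $V^{\pi}_{r,1}(x_1)$ subject to $V^\pi_{g,1}(x_1)\ge b$. Assume the Slater condition: $\gamma>0$ and some policy $\bar\pi$ has $V^{\bar\pi}_{g,1}(x_1)\ge b+\gamma$. **Algorithm (OPDOP with optimistic count-based evaluation).** Start with $Q^0_{r,h}=Q^0_{g,h}=0$, $\pi^0_h$ uniform, $Y^0=0$, $V^0_{g,1}(x_1)=b$, and put $\chi=2H/\gamma$. In episode $k=1,2,\dots$ set $$\pi^k_h(a\mid x)\propto\big((1-\theta)\pi^{k-1}_h(a\mid x)+\tfrac{\theta}{|\mathcal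 A|}\big)\exp\!\big(\alpha(Q^{k-1}_{r,h}+Y^{k-1}Q^{k-1}_{g,h})(x,a)\big),$$ play $\pi^k$ from $x_1$, observing $x_1^k=x_1,a_1^k,\dots,x_H^k,a_H^k,x_{H+1}^k$ and the rewards and utilities at the visited pairs, set $Y^k=\mathrm{Proj}_{[0,\chi]}\big(Y^{k-1}+\eta(b-V^{k-1}_{g,1}(x_1))\big)$, and compute for $\diamond\in\{r,g\}$, backwards from $V^k_{\diamond,H+1}=0$, $$Q^k_{\diamond,h}(x,a)=\min\Big(\hat\diamond^k_h(x,a)+\sum_{x'}\hat{\mathbb P}^k_h(x'\mid x,a)V^k_{\diamond,h+1}(x')+2\beta\,(n^k_h(x,a)+\lambda)^{-1/2},\;H-h+1\Big)^+,$$ $$V^k_{\diamond,h}(x)=\sum_aQ^k_{\diamond,h}(x,a)\,\pi^k_h(a\mid x),$$ where $n^k_h(x,a)$ and $n_h^k(x,a,x')$ count the episodes $\tau<k$ with $(x^\tau_h,a^\tau_h)=(x,a)$, respectively $(x^\tau_h,a^\tau_h,x^\tau_{h+1})=(x,a,x')$, and $\hat{\mathbb P}^k_h(x'\mid x,a)=\frac{n^k_h(x,a,x')}{n^k_h(x,a)+\lambda}$,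 $\hat\diamond^k_h(x,a)=\frac{1}{n^k_h(x,a)+\lambda}\sum_{\tau<k}\mathbf 1\{(x^\tau_h,a^\tau_h)=(x,a)\}\,\diamond_h(x^\tau_h,a^\tau_h)$. **Theorem.** There are absolute constants $C_1,C,C'>0$ such that the following holds for all such data and every $p\in(0,1)$. Run the algorithm with $\alpha=\frac{\sqrt{\log|\mathcal A|}}{H^2\sqrt K}$, $\beta=C_1H\sqrt{|\mathcal S|\log(|\mathcal S||\mathcal A|T/p)}$, $\eta=\frac1{\sqrt K}$, $\theta=\frac1K$, $\lambda=1$. Then, with probability at least $1-p$, both $$\sum_{k=1}^K\big(V^{\pi^\star}_{r,1}(x_1)-V^{\pi^k}_{r,1}(x_1)\big)\le C\Big(1+\frac1\gamma\Big)^2|\mathcal S|\sqrt{|\mathcal A|H^5T}\,\log\frac{|\mathcal S||\mathcal A|T}{p}$$ and $$\Big[\sum_{k=1}^K\big(b-V^{\pi^k}_{g,1}(x_1)\big)\Big]_+\le C'\Big(1+\frac1\gamma\Big)|\mathcal S|\sqrt{|\mathcal A|H^5T}\,\log\frac{|\mathcal S||\mathcal A|T}{p}.$$ -/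

import Mathlib

open scoped ENNReal

universe u v

/-- A trajectory of `n` steps: the states `x 0, …, x n` and the actions `a 0, …, a (n - 1)`.
Steps are numbered from `0` throughout, so step `h` here is step `h + 1` in the numbering
`1, …, H`. -/
abbrev Trajectory (S : Type u) (A : Type v) (n : ℕ) : Type (max u v) :=
  (Fin (n + 1) → S) × (Fin n → A)

/-- A Markov policy: a distribution over actions for every step and every state
(only the steps `h < H` matter). -/
abbrev Policy (S : Type u) (A : Type v) : Type (max u v) := ℕ → S → PMF A

/-- A finite-horizon constrained MDP with transition kernels `P`, deterministic reward `r` and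
utility `g` with values in `[0, 1]`, fixed initial state `x₁`, and constraint offset `b ∈ (0, H]`.
Only the entries at the steps `h < H` matter. -/
structure TabularCMDP (S : Type u) (A : Type v) (H : ℕ) where
  P : ℕ → S → A → PMF S
  r : ℕ → S → A → ℝ
  g : ℕ → S → A → ℝ
  x₁ : S
  b : ℝ
  r_mem : ∀ h < H, ∀ x a, r h x a ∈ Set.Icc (0 : ℝ) 1
  g_mem : ∀ h < H, ∀ x a, g h x a ∈ Set.Icc (0 : ℝ) 1
  b_mem : b ∈ Set.Ioc (0 : ℝ) H

/-- The parameters of the algorithm: step size `α`, bonus factor `β`, dual step size `η`,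
mixing weight `θ`, regularization `lam`, and upper end `χ` of the dual interval `[0, χ]`. -/
structure OPDOPParams where
  α : ℝ
  β : ℝ
  η : ℝ
  θ : ℝ
  lam : ℝ
  χ : ℝ

/-- What one iteration of the algorithm produces: the policy `π`, the dual variable `Y`, the
estimated action-value functions `Qr`, `Qg`, and the estimated utility value `Vg₁` at `x₁`. -/
structure OPDOPState (S : Type u) (A : Type v) where
  π : Policy S A
  Y : ℝ
  Qr : ℕ → S → A → ℝ
  Qg : ℕ → S → A → ℝ
  Vg₁ : ℝ

theorem policyUpdate_ne_zero {A : Type v} [Fintype A] [Nonempty A]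
    (θ : ℝ) (μ : PMF A) (f : A → ℝ) :
    (∑' a, (ENNReal.ofReal (1 - θ) * μ a + ENNReal.ofReal θ * (Fintype.card A : ℝ≥0∞)⁻¹)
      * ENNReal.ofReal (Real.exp (f a))) ≠ 0 := by
  intro h0
  rw [ENNReal.tsum_eq_zero] at h0
  obtain ⟨a, ha⟩ := μ.support_nonempty
  have hμ : μ a ≠ 0 := (μ.mem_support_iff a).1 ha
  have he : ENNReal.ofReal (Real.exp (f a)) ≠ 0 := by
    simpa using Real.exp_pos (f a)
  have h1 := (mul_eq_zero.1 (h0 a)).resolve_right he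
  rw [add_eq_zero] at h1
  have h2 : 1 - θ ≤ 0 := ENNReal.ofReal_eq_zero.1 ((mul_eq_zero.1 h1.1).resolve_right hμ)
  have h3 : θ ≤ 0 := ENNReal.ofReal_eq_zero.1
    ((mul_eq_zero.1 h1.2).resolve_right (ENNReal.inv_ne_zero.2 (ENNReal.natCast_ne_top _)))
  linarith

theorem policyUpdate_ne_top {A : Type v} [Fintype A] [Nonempty A]
    (θ : ℝ) (μ : PMF A) (f : A → ℝ) :
    (∑' a, (ENNReal.ofReal (1 - θ) * μ a + ENNReal.ofReal θ * (Fintype.card A : ℝ≥0∞)⁻¹)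
      * ENNReal.ofReal (Real.exp (f a))) ≠ ∞ := by
  rw [tsum_fintype]
  refine ENNReal.sum_ne_top.2 fun a _ => ?_
  refine ENNReal.mul_ne_top (ENNReal.add_ne_top.2 ⟨?_, ?_⟩) ENNReal.ofReal_ne_top
  · exact ENNReal.mul_ne_top ENNReal.ofReal_ne_top (μ.apply_ne_top a)
  · exact ENNReal.mul_ne_top ENNReal.ofReal_ne_top
      (ENNReal.inv_ne_top.2 (by exact_mod_cast Fintype.card_ne_zero))

/-- The distribution proportional to `((1 - θ) μ + θ Unif(A)) · exp f`, for `θ ∈ [0, 1]`. -/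
noncomputable def policyUpdate {A : Type v} [Fintype A] [Nonempty A]
    (θ : ℝ) (μ : PMF A) (f : A → ℝ) : PMF A :=
  PMF.normalize
    (fun a => (ENNReal.ofReal (1 - θ) * μ a + ENNReal.ofReal θ * (Fintype.card A : ℝ≥0∞)⁻¹)
      * ENNReal.ofReal (Real.exp (f a)))
    (policyUpdate_ne_zero θ μ f) (policyUpdate_ne_top θ μ f)

section Evaluation

variable {S : Type u} {A : Type v} {H n : ℕ}

/-- The number of episodes in the data `D` in which the state-action pair at step `h` is
`(x, a)`. -/
def visits [DecidableEq S] [DecidableEq A] (D : Fin n → Trajectory S A H)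
    (h : Fin H) (x : S) (a : A) : ℕ :=
  ∑ τ, if (D τ).1 h.castSucc = x ∧ (D τ).2 h = a then 1 else 0

/-- The number of episodes in the data `D` in which the state and action at step `h` and the next
state are `(x, a, x')`. -/
def visitsNext [DecidableEq S] [DecidableEq A] (D : Fin n → Trajectory S A H)
    (h : Fin H) (x : S) (a : A) (x' : S) : ℕ :=
  ∑ τ, if (D τ).1 h.castSucc = x ∧ (D τ).2 h = a ∧ (D τ).1 h.succ = x' then 1 else 0

/-- The estimate of a reward or utility function `f` from its values at the visited pairs. -/
noncomputable def estReward [DecidableEq S] [DecidableEq A] (lam : ℝ) (f : ℕ → S → A → ℝ)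
    (D : Fin n → Trajectory S A H) (h : Fin H) (x : S) (a : A) : ℝ :=
  (∑ τ, if (D τ).1 h.castSucc = x ∧ (D τ).2 h = a
    then f h ((D τ).1 h.castSucc) ((D τ).2 h) else 0) / (visits D h x a + lam)

/-- The estimated transition probability from `(x, a)` to `x'` at step `h`. -/
noncomputable def estTransition [DecidableEq S] [DecidableEq A] (lam : ℝ)
    (D : Fin n → Trajectory S A H) (h : Fin H) (x : S) (a : A) (x' : S) : ℝ :=
  visitsNext D h x a x' / (visits D h x a + lam)

/-- The bonus `β (n(x, a) + lam)^(-1/2)`. -/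
noncomputable def bonus [DecidableEq S] [DecidableEq A] (lam β : ℝ)
    (D : Fin n → Trajectory S A H) (h : Fin H) (x : S) (a : A) : ℝ :=
  β / Real.sqrt (visits D h x a + lam)

/-- The optimistic action-value function of the policy `π` for the reward or utility `f`, computed
from the data `D` by backward recursion, with truncation to `[0, H - h]` (which is
`[0, H - h + 1]` if steps are numbered from `1`); it is zero after the last step. -/
noncomputable def optQ [Fintype S] [Fintype A] [DecidableEq S] [DecidableEq A] (lam β : ℝ)
    (f : ℕ → S → A → ℝ) (D : Fin n → Trajectory S A H) (π : Policy S A) (h : ℕ) : S → A → ℝ :=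
  if hh : h < H then fun x a =>
    max (min
      (estReward lam f D ⟨h, hh⟩ x a
        + ∑ x', estTransition lam D ⟨h, hh⟩ x a x'
            * ∑ a', optQ lam β f D π (h + 1) x' a' * (π (h + 1) x' a').toReal
        + 2 * bonus lam β D ⟨h, hh⟩ x a)
      ((H : ℝ) - h)) 0
  else 0
termination_by H - h

/-- The optimistic value function `⟨Q h (x, ·), π h (· | x)⟩`. -/
noncomputable def optV [Fintype S] [Fintype A] [DecidableEq S] [DecidableEq A] (lam β : ℝ)
    (f : ℕ → S → A → ℝ) (D : Fin n → Trajectory S A H) (π : Policy S A) (h : ℕ) (x : S) : ℝ :=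
  ∑ a, optQ lam β f D π h x a * (π h x a).toReal

end Evaluation

namespace TabularCMDP

variable {S : Type u} {A : Type v} {H : ℕ}

/-- The law of the first `n` steps of an episode played with the policy `π` from `x₁`. -/
noncomputable def trajectoryLaw (M : TabularCMDP S A H) (π : Policy S A) :
    (n : ℕ) → PMF (Trajectory S A n)
  | 0 => PMF.pure (fun _ => M.x₁, fun i => i.elim0)
  | n + 1 => (M.trajectoryLaw π n).bind fun t =>
      (π n (t.1 (Fin.last n))).bind fun a =>
        (M.P n (t.1 (Fin.last n)) a).map fun x' =>
          ((Fin.snoc t.1 x' : Fin (n + 2) → S), (Fin.snoc t.2 a : Fin (n + 1) → A))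

/-- The value of the policy `π` at `x₁` in the first step, for the reward or utility `f`:
the expected total of `f` over an episode. -/
noncomputable def value [Fintype S] [Fintype A] (M : TabularCMDP S A H)
    (f : ℕ → S → A → ℝ) (π : Policy S A) : ℝ :=
  ∑ e : Trajectory S A H,
    (M.trajectoryLaw π H e).toReal * ∑ h : Fin H, f h (e.1 h.castSucc) (e.2 h)

/-- `π` solves: maximize the value of `r` subject to the value of `g` being at least `b`. -/
def IsOptimal [Fintype S] [Fintype A] (M : TabularCMDP S A H) (π : Policy S A) : Prop :=
  M.b ≤ M.value M.g π ∧
    ∀ π' : Policy S A, M.b ≤ M.value M.g π' → M.value M.r π' ≤ M.value M.r π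

/-- The Slater condition with constant `γ`. -/
def Slater [Fintype S] [Fintype A] (M : TabularCMDP S A H) (γ : ℝ) : Prop :=
  0 < γ ∧ ∃ π : Policy S A, M.b + γ ≤ M.value M.g π

variable [Fintype S] [Fintype A] [DecidableEq S] [DecidableEq A] [Nonempty A]

/-- The state of the algorithm before the first iteration. -/
noncomputable def opdopInit (M : TabularCMDP S A H) : OPDOPState S A where
  π := fun _ _ => PMF.uniformOfFintype A
  Y := 0
  Qr := 0
  Qg := 0
  Vg₁ := M.b

/-- One iteration: policy improvement and dual update from the previous iteration `s`, then
optimistic evaluation of the new policy from the data `D` of all earlier episodes. -/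
noncomputable def opdopStep (M : TabularCMDP S A H) (c : OPDOPParams) {n : ℕ}
    (s : OPDOPState S A) (D : Fin n → Trajectory S A H) : OPDOPState S A :=
  let π : Policy S A := fun h x =>
    policyUpdate c.θ (s.π h x) fun a => c.α * (s.Qr h x a + s.Y * s.Qg h x a)
  { π := π
    Y := max 0 (min c.χ (s.Y + c.η * (M.b - s.Vg₁)))
    Qr := optQ c.lam c.β M.r D π
    Qg := optQ c.lam c.β M.g D π
    Vg₁ := optV c.lam c.β M.g D π 0 M.x₁ }

/-- Iteration `n + 1` of the algorithm, as a function of the first `n` episodes. -/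
noncomputable def opdop (M : TabularCMDP S A H) (c : OPDOPParams) :
    (n : ℕ) → (Fin n → Trajectory S A H) → OPDOPState S A
  | 0, D => M.opdopStep c M.opdopInit D
  | n + 1, D => M.opdopStep c (M.opdop c n fun i => D i.castSucc) D

/-- The law of the first `n` episodes: episode `n + 1` is played with the policy that the algorithm
computes from the first `n` episodes. -/
noncomputable def runLaw (M : TabularCMDP S A H) (c : OPDOPParams) :
    (n : ℕ) → PMF (Fin n → Trajectory S A H)
  | 0 => PMF.pure fun i => i.elim0
  | n + 1 => (M.runLaw c n).bind fun D =>
      (M.trajectoryLaw (M.opdop c n D).π H).map fun e =>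
        (Fin.snoc D e : Fin (n + 1) → Trajectory S A H)

/-- The policy played in the episode with index `k` (counted from `0`) of the run `ω`. -/
noncomputable def playedPolicy (M : TabularCMDP S A H) (c : OPDOPParams) {K : ℕ}
    (ω : Fin K → Trajectory S A H) (k : Fin K) : Policy S A :=
  (M.opdop c k fun i => ω (Fin.castLE k.isLt.le i)).π

/-- The regret of the run `ω` of `K` episodes with respect to the policy `πstar`. -/
noncomputable def regret (M : TabularCMDP S A H) (c : OPDOPParams) (πstar : Policy S A) {K : ℕ}
    (ω : Fin K → Trajectory S A H) : ℝ :=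
  ∑ k, (M.value M.r πstar - M.value M.r (M.playedPolicy c ω k))

/-- The constraint violation of the run `ω` of `K` episodes. -/
noncomputable def violation (M : TabularCMDP S A H) (c : OPDOPParams) {K : ℕ}
    (ω : Fin K → Trajectory S A H) : ℝ :=
  max (∑ k, (M.b - M.value M.g (M.playedPolicy c ω k))) 0

end TabularCMDP

/-- The parameters as functions of the numbers `nS = |S|`, `nA = |A|`, `H`, `K`, the Slater
constant `γ`, the failure probability `p` and the constant `C₁`; `H * K` is the number `T` of
steps. -/
noncomputable def tabularParams (C₁ : ℝ) (nS nA H K : ℕ) (γ p : ℝ) : OPDOPParams where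
  α := Real.sqrt (Real.log nA) / (H ^ 2 * Real.sqrt K)
  β := C₁ * H * Real.sqrt (nS * Real.log (nS * nA * (H * K) / p))
  η := 1 / Real.sqrt K
  θ := 1 / K
  lam := 1
  χ := 2 * H / γ

/-! The proof is a primal-dual regret analysis on an event where the model estimates are accurate.
On that event the optimistic `optQ` exceeds its own Bellman backup by an amount between zero and a
few bonuses (`optQ_sub_backup_mem`). By the value difference identity `value_sub_eq`, the estimated
values are then optimistic up to the policy regret of mirror descent, and they exceed the true
values of the played policy by at most its expected bonuses.

For any fixed multiplier `y` in `[0, χ]`, the sum of reward regret and `y` times the signed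
constraint violation is bounded by three terms (`lagrangian_regret_le`): mirror descent at every
state and step, projected gradient descent for the dual variable, and the bonuses. The choice `y =
0` gives the regret. The choice `y = χ = 2 * H / γ` gives the violation without strong duality:
mixing the played policies with the Slater policy yields a feasible Markov policy
(`exists_mixture`), so optimality limits how negative the regret can be.

The accurate event comes from exponential supermartingales. The next value function depends on the
data, so what is controlled is the excess of transitions into every subset of `S`; this bounds the
error for all bounded value functions at once. The union over `2 ^ |S|` subsets is the source of the
factor `√|S|` in `β`. A second supermartingale compares expected with observed uncertainty, and a
pigeonhole sum bounds the latter. -/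

/-! ### Expectations and exponential moments on finite types. -/

section Mean

variable {α β : Type*} [Fintype α] [Fintype β]

/-- The expectation of a real function under a distribution on a finite type. -/
noncomputable def PMF.mean (q : PMF α) (f : α → ℝ) : ℝ := ∑ a, (q a).toReal * f a

theorem PMF.sum_toReal (q : PMF α) : ∑ a, (q a).toReal = 1 := by
  rw [← ENNReal.toReal_sum fun a _ => q.apply_ne_top a, ← tsum_fintype (L := .unconditional α),
    q.tsum_coe, ENNReal.toReal_one]

theorem PMF.mean_const (q : PMF α) (c : ℝ) : q.mean (fun _ => c) = c := by
  rw [PMF.mean, ← Finset.sum_mul, q.sum_toReal, one_mul]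

theorem PMF.mean_add (q : PMF α) (f g : α → ℝ) :
    q.mean (fun a => f a + g a) = q.mean f + q.mean g := by
  simp only [PMF.mean, mul_add, Finset.sum_add_distrib]

theorem PMF.mean_sub (q : PMF α) (f g : α → ℝ) :
    q.mean (fun a => f a - g a) = q.mean f - q.mean g := by
  simp only [PMF.mean, mul_sub, Finset.sum_sub_distrib]

theorem PMF.mean_const_mul (q : PMF α) (c : ℝ) (f : α → ℝ) :
    q.mean (fun a => c * f a) = c * q.mean f := by
  simp only [PMF.mean, Finset.mul_sum]
  exact Finset.sum_congr rfl fun a _ => by ring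

theorem PMF.mean_mul_const (q : PMF α) (c : ℝ) (f : α → ℝ) :
    q.mean (fun a => f a * c) = q.mean f * c := by
  simp only [PMF.mean, Finset.sum_mul]
  exact Finset.sum_congr rfl fun a _ => by ring

theorem PMF.mean_sum {ι : Type*} (q : PMF α) (s : Finset ι) (f : ι → α → ℝ) :
    q.mean (fun a => ∑ i ∈ s, f i a) = ∑ i ∈ s, q.mean (f i) := by
  simp only [PMF.mean, Finset.mul_sum]
  exact Finset.sum_comm

theorem PMF.mean_mono (q : PMF α) {f g : α → ℝ} (h : ∀ a, f a ≤ g a) : q.mean f ≤ q.mean g :=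
  Finset.sum_le_sum fun a _ => mul_le_mul_of_nonneg_left (h a) ENNReal.toReal_nonneg

theorem PMF.mean_nonneg (q : PMF α) {f : α → ℝ} (h : ∀ a, 0 ≤ f a) : 0 ≤ q.mean f :=
  Finset.sum_nonneg fun a _ => mul_nonneg ENNReal.toReal_nonneg (h a)

theorem PMF.mean_le (q : PMF α) {f : α → ℝ} {c : ℝ} (h : ∀ a, f a ≤ c) : q.mean f ≤ c :=
  (q.mean_mono h).trans_eq (q.mean_const c)

theorem PMF.mean_bind (q : PMF α) (k : α → PMF β) (f : β → ℝ) :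
    (q.bind k).mean f = q.mean fun a => (k a).mean f := by
  simp only [PMF.mean, PMF.bind_apply, tsum_fintype]
  simp_rw [ENNReal.toReal_sum fun a _ => ENNReal.mul_ne_top (q.apply_ne_top a)
    ((k a).apply_ne_top _), ENNReal.toReal_mul, Finset.sum_mul, Finset.mul_sum]
  rw [Finset.sum_comm]
  exact Finset.sum_congr rfl fun a _ => Finset.sum_congr rfl fun b _ => by ring

theorem PMF.mean_pure (a : α) (f : α → ℝ) : (PMF.pure a).mean f = f a := by
  classical
  simp only [PMF.mean, PMF.pure_apply]
  rw [Finset.sum_eq_single a]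
  · simp
  · intro b _ hb
    simp [hb]
  · simp

theorem PMF.mean_map (q : PMF α) (g : α → β) (f : β → ℝ) :
    (q.map g).mean f = q.mean fun a => f (g a) := by
  rw [PMF.map, PMF.mean_bind]
  simp only [Function.comp, PMF.mean_pure]

/-- For a centred variable the linear term has mean zero, so only the exponential of the squared
range survives. The constant is worse than Hoeffding's, which is harmless here. -/
theorem Real.exp_le_add_exp_sq (x : ℝ) : Real.exp x ≤ x + Real.exp (x ^ 2) := by
  have h1 := Real.add_one_le_exp (x ^ 2)
  rcases le_or_gt |x| 1 with h | h
  · have := (abs_le.1 (Real.abs_exp_sub_one_sub_id_le h)).2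
    linarith
  · rcases lt_abs.1 h with h | h
    · have : Real.exp x ≤ Real.exp (x ^ 2) := Real.exp_le_exp.2 (by nlinarith)
      linarith
    · have : Real.exp x ≤ 1 := Real.exp_le_one_iff.2 (by linarith)
      nlinarith

/-- Holds because `(1 - x / 2) * (1 + x) ≥ 1` on `[0, 1]`. The slope `1 / 2` is what later costs a
factor 2 between expected and observed uncertainty. -/
theorem Real.exp_neg_le_one_sub_half {x : ℝ} (h0 : 0 ≤ x) (h1 : x ≤ 1) :
    Real.exp (-x) ≤ 1 - x / 2 := by
  have h2 := Real.add_one_le_exp x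
  rw [Real.exp_neg, inv_le_comm₀ (Real.exp_pos x) (by linarith)]
  refine le_trans ?_ h2
  rw [inv_le_iff_one_le_mul₀ (by linarith)]
  nlinarith

/-- A bound on the moment generating function of a centred bounded variable. -/
theorem PMF.mean_exp_centred_le (q : PMF α) {f : α → ℝ} {B : ℝ} (h0 : ∀ a, 0 ≤ f a)
    (hB : ∀ a, f a ≤ B) : q.mean (fun a => Real.exp (f a - q.mean f)) ≤ Real.exp (B ^ 2) := by
  have hm0 := q.mean_nonneg h0
  have hmB := q.mean_le hB
  calc q.mean (fun a => Real.exp (f a - q.mean f))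
      ≤ q.mean (fun a => (f a - q.mean f) + Real.exp (B ^ 2)) := by
        refine q.mean_mono fun a => (Real.exp_le_add_exp_sq _).trans ?_
        have : (f a - q.mean f) ^ 2 ≤ B ^ 2 := by
          refine sq_le_sq' ?_ ?_ <;> linarith [h0 a, hB a]
        gcongr
    _ = Real.exp (B ^ 2) := by
        rw [q.mean_add, q.mean_sub, q.mean_const, q.mean_const]
        ring

/-- The moment bound behind the comparison of the sum of the conditional means of variables in
`[0, 1]` with their sum. -/
theorem PMF.mean_exp_half_mean_sub_le (q : PMF α) {f : α → ℝ} (h0 : ∀ a, 0 ≤ f a)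
    (h1 : ∀ a, f a ≤ 1) : q.mean (fun a => Real.exp (q.mean f / 2 - f a)) ≤ 1 := by
  have h : q.mean (fun a => Real.exp (-f a)) ≤ Real.exp (-(q.mean f / 2)) :=
    calc q.mean (fun a => Real.exp (-f a)) ≤ q.mean (fun a => 1 - 1 / 2 * f a) :=
          q.mean_mono fun a => by
            have := Real.exp_neg_le_one_sub_half (h0 a) (h1 a)
            linarith
      _ = 1 - q.mean f / 2 := by
          rw [q.mean_sub, q.mean_const, q.mean_const_mul]
          ring
      _ ≤ _ := by
          have := Real.add_one_le_exp (-(q.mean f / 2))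
          linarith
  simp_rw [sub_eq_add_neg, Real.exp_add]
  rw [q.mean_const_mul]
  calc _ ≤ Real.exp (q.mean f / 2) * Real.exp (-(q.mean f / 2)) := by gcongr
    _ = 1 := by rw [← Real.exp_add]; simp

/-- A set has probability at least `1 - p` if its complement is dominated by a function of mean
at most `p`. -/
theorem PMF.ofReal_one_sub_le_toOuterMeasure (q : PMF α) (s : Set α) {G : α → ℝ} {p : ℝ}
    (hG : ∀ a, 0 ≤ G a) (hp : q.mean G ≤ p) (hs : ∀ a, a ∉ s → 1 ≤ G a) :
    ENNReal.ofReal (1 - p) ≤ q.toOuterMeasure s := by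
  classical
  have h1 : q.toOuterMeasure s = ENNReal.ofReal (q.mean (s.indicator 1)) := by
    rw [PMF.toOuterMeasure_apply, tsum_fintype, PMF.mean,
      ENNReal.ofReal_sum_of_nonneg fun a _ => mul_nonneg ENNReal.toReal_nonneg
        (Set.indicator_nonneg (by simp) _)]
    refine Finset.sum_congr rfl fun a _ => ?_
    by_cases ha : a ∈ s
    · simp [ha, ENNReal.ofReal_toReal (q.apply_ne_top a)]
    · simp [ha]
  rw [h1]
  apply ENNReal.ofReal_le_ofReal
  have h2 : q.mean (fun a => 1 - G a) ≤ q.mean (s.indicator 1) := q.mean_mono fun a => by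
    by_cases ha : a ∈ s
    · simp [ha, hG a]
    · simp [ha, hs a ha]
  rw [q.mean_sub, q.mean_const] at h2
  linarith

end Mean

/-! ### Occupancy measures, mixtures of policies and the value difference identity. -/

namespace TabularCMDP

variable {S : Type u} {A : Type v} {H : ℕ} [Fintype S] [Fintype A]

/-- The probability that the state at step `h` is `x`, under the policy `π`. -/
noncomputable def occ (M : TabularCMDP S A H) (π : Policy S A) : ℕ → S → ℝ
  | 0, x => ((PMF.pure M.x₁ : PMF S) x).toReal
  | h + 1, x' => ∑ x, M.occ π h x * (π h x).mean fun a => (M.P h x a x').toReal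

theorem occ_nonneg (M : TabularCMDP S A H) (π : Policy S A) (h : ℕ) (x : S) :
    0 ≤ M.occ π h x := by
  induction h generalizing x with
  | zero => exact ENNReal.toReal_nonneg
  | succ h ih =>
    exact Finset.sum_nonneg fun y _ => mul_nonneg (ih y)
      (PMF.mean_nonneg _ fun _ => ENNReal.toReal_nonneg)

theorem sum_occ_zero_mul (M : TabularCMDP S A H) (π : Policy S A) (φ : S → ℝ) :
    ∑ x, M.occ π 0 x * φ x = φ M.x₁ :=
  PMF.mean_pure M.x₁ φ

/-- The forward equation in dual form, tested against `φ`; this is what lets sums over steps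
telescope. -/
theorem sum_occ_succ_mul (M : TabularCMDP S A H) (π : Policy S A) (h : ℕ) (φ : S → ℝ) :
    ∑ x, M.occ π (h + 1) x * φ x
      = ∑ x, M.occ π h x * (π h x).mean fun a => (M.P h x a).mean φ := by
  have key : ∀ x, (π h x).mean (fun a => (M.P h x a).mean φ)
      = ∑ x', (π h x).mean (fun a => (M.P h x a x').toReal) * φ x' := fun x => by
    simp_rw [← PMF.mean_mul_const]
    rw [← PMF.mean_sum]
    rfl
  simp_rw [key, occ, Finset.sum_mul, Finset.mul_sum]
  rw [Finset.sum_comm]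
  exact Finset.sum_congr rfl fun x _ => Finset.sum_congr rfl fun y _ => by ring

theorem sum_occ (M : TabularCMDP S A H) (π : Policy S A) (h : ℕ) : ∑ x, M.occ π h x = 1 := by
  induction h with
  | zero => simpa using M.sum_occ_zero_mul π fun _ => 1
  | succ h ih =>
    have := M.sum_occ_succ_mul π h fun _ => 1
    simp only [mul_one, PMF.mean_const, ih] at this
    exact this

theorem sum_occ_mul_le (M : TabularCMDP S A H) (π : Policy S A) (h : ℕ) {φ : S → ℝ} {c : ℝ}
    (hφ : ∀ x, φ x ≤ c) : ∑ x, M.occ π h x * φ x ≤ c :=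
  calc ∑ x, M.occ π h x * φ x ≤ ∑ x, M.occ π h x * c :=
        Finset.sum_le_sum fun x _ => mul_le_mul_of_nonneg_left (hφ x) (M.occ_nonneg π h x)
    _ = c := by rw [← Finset.sum_mul, sum_occ, one_mul]

theorem mean_trajectoryLaw_succ (M : TabularCMDP S A H) (π : Policy S A) (n : ℕ)
    (F : Trajectory S A (n + 1) → ℝ) :
    (M.trajectoryLaw π (n + 1)).mean F = (M.trajectoryLaw π n).mean fun t =>
      (π n (t.1 (Fin.last n))).mean fun a => (M.P n (t.1 (Fin.last n)) a).mean fun x' =>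
        F ((Fin.snoc t.1 x' : Fin (n + 2) → S), (Fin.snoc t.2 a : Fin (n + 1) → A)) := by
  rw [trajectoryLaw, PMF.mean_bind]
  simp only [PMF.mean_bind, PMF.mean_map]

theorem mean_trajectoryLaw_last (M : TabularCMDP S A H) (π : Policy S A) (n : ℕ) (φ : S → ℝ) :
    (M.trajectoryLaw π n).mean (fun t => φ (t.1 (Fin.last n))) = ∑ x, M.occ π n x * φ x := by
  induction n generalizing φ with
  | zero => rw [sum_occ_zero_mul, trajectoryLaw, PMF.mean_pure]
  | succ n ih =>
    rw [mean_trajectoryLaw_succ, sum_occ_succ_mul]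
    simp only [Fin.snoc_last]
    exact ih fun x => (π n x).mean fun a => (M.P n x a).mean φ

/-- Reduces additive functionals of an episode to occupancies: values, uncertainties and one-step
exponential moments are all instances. -/
theorem mean_trajectoryLaw_sum (M : TabularCMDP S A H) (π : Policy S A) (n : ℕ)
    (ψ : ℕ → S → A → S → ℝ) :
    (M.trajectoryLaw π n).mean (fun t => ∑ h : Fin n, ψ h (t.1 h.castSucc) (t.2 h) (t.1 h.succ))
      = ∑ h ∈ Finset.range n, ∑ x, M.occ π h x *
          (π h x).mean fun a => (M.P h x a).mean fun x' => ψ h x a x' := by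
  induction n with
  | zero => simp [PMF.mean_const]
  | succ n ih =>
    rw [mean_trajectoryLaw_succ, Finset.sum_range_succ, ← ih, ← mean_trajectoryLaw_last,
      ← PMF.mean_add]
    congr 1
    funext t
    have : ∀ (a : A) (x' : S), (∑ h : Fin (n + 1),
        ψ h ((Fin.snoc t.1 x' : Fin (n + 2) → S) h.castSucc)
          ((Fin.snoc t.2 a : Fin (n + 1) → A) h) ((Fin.snoc t.1 x' : Fin (n + 2) → S) h.succ))
        = (∑ h : Fin n, ψ h (t.1 h.castSucc) (t.2 h) (t.1 h.succ))
          + ψ n (t.1 (Fin.last n)) a x' := fun a x' => by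
      rw [Fin.sum_univ_castSucc]
      simp only [Fin.snoc_castSucc, Fin.snoc_last, Fin.succ_castSucc, Fin.succ_last,
        Fin.val_castSucc, Fin.val_last]
    simp only [this, PMF.mean_add, PMF.mean_const]

theorem value_eq (M : TabularCMDP S A H) (π : Policy S A) (f : ℕ → S → A → ℝ) :
    M.value f π = ∑ h ∈ Finset.range H, ∑ x, M.occ π h x * (π h x).mean (f h x) := by
  have := M.mean_trajectoryLaw_sum π H fun h x a _ => f h x a
  simp only [PMF.mean_const] at this
  exact this

theorem value_nonneg (M : TabularCMDP S A H) (π : Policy S A) {f : ℕ → S → A → ℝ}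
    (hf : ∀ h < H, ∀ x a, f h x a ∈ Set.Icc (0 : ℝ) 1) : 0 ≤ M.value f π := by
  rw [value_eq]
  exact Finset.sum_nonneg fun h hh => Finset.sum_nonneg fun x _ => mul_nonneg
    (M.occ_nonneg π h x) (PMF.mean_nonneg _ fun a => (hf h (Finset.mem_range.1 hh) x a).1)

theorem value_le (M : TabularCMDP S A H) (π : Policy S A) {f : ℕ → S → A → ℝ}
    (hf : ∀ h < H, ∀ x a, f h x a ∈ Set.Icc (0 : ℝ) 1) : M.value f π ≤ H := by
  rw [value_eq]
  calc _ ≤ ∑ h ∈ Finset.range H, (1 : ℝ) := Finset.sum_le_sum fun h hh =>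
        M.sum_occ_mul_le π h fun x => PMF.mean_le _ fun a => (hf h (Finset.mem_range.1 hh) x a).2
    _ = H := by simp

/-- Convex combinations of the values of Markov policies are values of Markov policies. -/
theorem exists_mixture {ι : Type*} [Fintype ι] (M : TabularCMDP S A H) (w : ι → ℝ)
    (hw : ∀ i, 0 ≤ w i) (hw1 : ∑ i, w i = 1) (π : ι → Policy S A) :
    ∃ π' : Policy S A, ∀ f, M.value f π' = ∑ i, w i * M.value f (π i) := by
  classical
  have hne : Nonempty ι := by
    by_contra hne
    rw [not_nonempty_iff] at hne
    simp at hw1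
  obtain ⟨i₀⟩ := hne
  set d : ℕ → S → ℝ := fun h x => ∑ i, w i * M.occ (π i) h x with hd
  have hd0 : ∀ h x, 0 ≤ d h x := fun h x =>
    Finset.sum_nonneg fun i _ => mul_nonneg (hw i) (M.occ_nonneg _ h x)
  -- The mixed policy acts by the posterior: at `(h, x)` it follows policy `i` with probability
  -- proportional to `w i` times its occupancy of `x`.
  have hex : ∀ h x, ∃ q : PMF A, ∀ φ : A → ℝ,
      d h x * q.mean φ = ∑ i, w i * M.occ (π i) h x * (π i h x).mean φ := by
    intro h x
    rcases (hd0 h x).eq_or_lt with h0 | h0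
    -- A state of mixed occupancy zero carries no mass for any `i` with positive weight, so any
    -- action distribution will do.
    · refine ⟨π i₀ h x, fun φ => ?_⟩
      have hz := (Finset.sum_eq_zero_iff_of_nonneg fun i _ =>
        mul_nonneg (hw i) (M.occ_nonneg (π i) h x)).1 h0.symm
      rw [← h0, zero_mul]
      exact (Finset.sum_eq_zero fun i hi => by rw [hz i hi, zero_mul]).symm
    · have hs : ∀ i, 0 ≤ w i * M.occ (π i) h x / d h x := fun i =>
        div_nonneg (mul_nonneg (hw i) (M.occ_nonneg _ h x)) h0.le
      have hs1 : ∑ i, w i * M.occ (π i) h x / d h x = 1 := by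
        rw [← Finset.sum_div, div_self h0.ne']
      let m : PMF ι := PMF.ofFintype (fun i => ENNReal.ofReal (w i * M.occ (π i) h x / d h x)) (by
        rw [← ENNReal.ofReal_sum_of_nonneg fun i _ => hs i, hs1, ENNReal.ofReal_one])
      refine ⟨m.bind fun i => π i h x, fun φ => ?_⟩
      rw [PMF.mean_bind, PMF.mean, Finset.mul_sum]
      refine Finset.sum_congr rfl fun i _ => ?_
      rw [PMF.ofFintype_apply, ENNReal.toReal_ofReal (hs i)]
      field_simp
  choose π' hπ' using hex
  have hocc : ∀ h x, M.occ π' h x = d h x := by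
    intro h
    induction h with
    | zero =>
      intro x
      simp only [hd, occ, ← Finset.sum_mul, hw1, one_mul]
    | succ h ih =>
      intro x'
      simp only [occ, ih, hπ']
      simp only [hd, occ, Finset.mul_sum]
      rw [Finset.sum_comm]
      exact Finset.sum_congr rfl fun i _ => Finset.sum_congr rfl fun x _ => by ring
  refine ⟨π', fun f => ?_⟩
  simp only [value_eq, hocc, hπ', Finset.mul_sum]
  rw [Finset.sum_comm (s := Finset.univ) (t := Finset.range H)]
  refine Finset.sum_congr rfl fun h _ => ?_
  rw [Finset.sum_comm]
  exact Finset.sum_congr rfl fun i _ => Finset.sum_congr rfl fun x _ => by ring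

/-- The value difference identity: `Q` is any action-value function that vanishes after the last
step, and `ρ` the policy that defines the values of `Q`. -/
theorem value_sub_eq (M : TabularCMDP S A H) (π ρ : Policy S A) (f Q : ℕ → S → A → ℝ)
    (hQ : Q H = 0) :
    M.value f π - (ρ 0 M.x₁).mean (Q 0 M.x₁)
      = (∑ h ∈ Finset.range H, ∑ x, M.occ π h x * ((π h x).mean (Q h x) - (ρ h x).mean (Q h x)))
        - ∑ h ∈ Finset.range H, ∑ x, M.occ π h x * (π h x).mean fun a =>
            Q h x a - (f h x a + (M.P h x a).mean fun x' =>
              (ρ (h + 1) x').mean (Q (h + 1) x')) := by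
  set V : ℕ → S → ℝ := fun h x => (ρ h x).mean (Q h x) with hV
  have h0 : ∑ x, M.occ π 0 x * V 0 x = V 0 M.x₁ := M.sum_occ_zero_mul π _
  have hH : ∑ x, M.occ π H x * V H x = 0 := Finset.sum_eq_zero fun x _ => by
    simp [hV, hQ, PMF.mean]
  -- The values `V` of `ρ` are telescoped along the occupancies of `π`, from `V 0 M.x₁` down to zero
  -- after the last step.
  have htel := Finset.sum_range_sub (fun h => ∑ x, M.occ π h x * V h x) H
  rw [h0, hH] at htel
  have h1 : V 0 M.x₁ = (ρ 0 M.x₁).mean (Q 0 M.x₁) := rfl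
  rw [← h1, value_eq, ← sub_eq_zero, ← Finset.sum_sub_distrib]
  rw [show V 0 M.x₁ = -∑ h ∈ Finset.range H, (∑ x, M.occ π (h + 1) x * V (h + 1) x
    - ∑ x, M.occ π h x * V h x) by linarith, sub_neg_eq_add, ← Finset.sum_add_distrib,
    ← Finset.sum_sub_distrib]
  refine Finset.sum_eq_zero fun h _ => ?_
  rw [sum_occ_succ_mul]
  simp only [PMF.mean_sub, PMF.mean_add, ← Finset.sum_sub_distrib, ← Finset.sum_add_distrib]
  exact Finset.sum_eq_zero fun x _ => by ring

end TabularCMDP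

/-! ### Mirror descent, projected gradient descent and the pigeonhole sum. -/

section OnlineLearning

variable {A : Type v} [Fintype A] [Nonempty A]

theorem toReal_policyUpdate {θ : ℝ} (h0 : 0 ≤ θ) (h1 : θ ≤ 1) (μ : PMF A) (f : A → ℝ) (a : A) :
    (policyUpdate θ μ f a).toReal
      = ((1 - θ) * (μ a).toReal + θ * (Fintype.card A : ℝ)⁻¹) * Real.exp (f a)
        / ∑ a', ((1 - θ) * (μ a').toReal + θ * (Fintype.card A : ℝ)⁻¹) * Real.exp (f a') := by
  have key : ∀ a, ((ENNReal.ofReal (1 - θ) * μ a + ENNReal.ofReal θ * (Fintype.card A : ℝ≥0∞)⁻¹)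
      * ENNReal.ofReal (Real.exp (f a))).toReal
      = ((1 - θ) * (μ a).toReal + θ * (Fintype.card A : ℝ)⁻¹) * Real.exp (f a) := fun a => by
    have hc : (Fintype.card A : ℝ≥0∞)⁻¹ ≠ ∞ :=
      ENNReal.inv_ne_top.2 (by exact_mod_cast Fintype.card_ne_zero)
    rw [ENNReal.toReal_mul, ENNReal.toReal_add
      (ENNReal.mul_ne_top ENNReal.ofReal_ne_top (μ.apply_ne_top a))
      (ENNReal.mul_ne_top ENNReal.ofReal_ne_top hc), ENNReal.toReal_mul, ENNReal.toReal_mul,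
      ENNReal.toReal_ofReal (by linarith), ENNReal.toReal_ofReal h0,
      ENNReal.toReal_ofReal (Real.exp_pos _).le, ENNReal.toReal_inv, ENNReal.toReal_natCast]
  have hne : ∀ a, ((ENNReal.ofReal (1 - θ) * μ a
      + ENNReal.ofReal θ * (Fintype.card A : ℝ≥0∞)⁻¹) * ENNReal.ofReal (Real.exp (f a))) ≠ ∞ :=
    fun a => ENNReal.ne_top_of_tsum_ne_top (policyUpdate_ne_top θ μ f) a
  rw [policyUpdate, PMF.normalize_apply, ENNReal.toReal_mul, key, ENNReal.toReal_inv,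
    tsum_fintype, ENNReal.toReal_sum fun a _ => hne a, div_eq_mul_inv]
  simp only [key]

theorem toReal_policyUpdate_zero {θ : ℝ} (h0 : 0 ≤ θ) (h1 : θ ≤ 1) (μ : PMF A) (a : A) :
    (policyUpdate θ μ (fun _ => 0) a).toReal
      = (1 - θ) * (μ a).toReal + θ * (Fintype.card A : ℝ)⁻¹ := by
  have hA : (Fintype.card A : ℝ) ≠ 0 := by exact_mod_cast Fintype.card_ne_zero
  rw [toReal_policyUpdate h0 h1]
  simp only [Real.exp_zero, mul_one, Finset.sum_add_distrib, ← Finset.mul_sum, μ.sum_toReal,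
    Finset.sum_const, Finset.card_univ, nsmul_eq_mul]
  field_simp
  ring

theorem toReal_uniformOfFintype (a : A) :
    (PMF.uniformOfFintype A a).toReal = (Fintype.card A : ℝ)⁻¹ := by
  simp

theorem policyUpdate_uniform {θ : ℝ} (h0 : 0 ≤ θ) (h1 : θ ≤ 1) :
    policyUpdate θ (PMF.uniformOfFintype A) (fun _ => 0) = PMF.uniformOfFintype A := by
  ext a
  rw [← ENNReal.toReal_eq_toReal_iff' (PMF.apply_ne_top _ _) (PMF.apply_ne_top _ _),
    toReal_policyUpdate_zero h0 h1, toReal_uniformOfFintype]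
  ring

/-- One step of mirror descent with uniform mixing. -/
theorem mirrorDescent_step {θ α B : ℝ} (h0 : 0 < θ) (h1 : θ ≤ 1) (hα : 0 < α) (μ q : PMF A)
    {f : A → ℝ} (hf0 : ∀ a, 0 ≤ f a) (hfB : ∀ a, f a ≤ B) :
    α * (q.mean f - μ.mean f) ≤ q.mean (fun a =>
      Real.log (policyUpdate θ μ (fun a => α * f a) a).toReal
        - Real.log ((1 - θ) * (μ a).toReal + θ * (Fintype.card A : ℝ)⁻¹))
      + (α * (θ * B) + (α * B) ^ 2) := by
  have hA : 0 < (Fintype.card A : ℝ)⁻¹ := inv_pos.2 (by exact_mod_cast Fintype.card_pos)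
  -- The update with zero exponent is the mixture of `μ` with the uniform distribution; the true
  -- update is an exponential tilt of `ν` with normalizer `Z`.
  set ν : PMF A := policyUpdate θ μ (fun _ => 0) with hν
  have hνa : ∀ a, (ν a).toReal = (1 - θ) * (μ a).toReal + θ * (Fintype.card A : ℝ)⁻¹ := fun a =>
    toReal_policyUpdate_zero h0.le h1 μ a
  have hνpos : ∀ a, 0 < (ν a).toReal := fun a => by
    rw [hνa]
    have : 0 ≤ (1 - θ) * (μ a).toReal := mul_nonneg (by linarith) ENNReal.toReal_nonneg
    positivity
  have hB : 0 ≤ B := (hf0 (Classical.arbitrary A)).trans (hfB _)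
  set Z : ℝ := ν.mean fun a => Real.exp (α * f a) with hZ
  have hZpos : 0 < Z := Finset.sum_pos (fun a _ => mul_pos (hνpos a) (Real.exp_pos _))
    Finset.univ_nonempty
  have hup : ∀ a, Real.log (policyUpdate θ μ (fun a => α * f a) a).toReal
      - Real.log ((1 - θ) * (μ a).toReal + θ * (Fintype.card A : ℝ)⁻¹)
      = α * f a - Real.log Z := fun a => by
    rw [toReal_policyUpdate h0.le h1]
    simp only [← hνa]
    change Real.log ((ν a).toReal * Real.exp (α * f a) / Z) - _ = _
    rw [Real.log_div (mul_pos (hνpos a) (Real.exp_pos _)).ne' hZpos.ne',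
      Real.log_mul (hνpos a).ne' (Real.exp_pos _).ne', Real.log_exp]
    ring
  have hlogZ : Real.log Z ≤ α * ν.mean f + (α * B) ^ 2 := by
    have h := ν.mean_exp_centred_le (f := fun a => α * f a) (B := α * B)
      (fun a => mul_nonneg hα.le (hf0 a)) (fun a => mul_le_mul_of_nonneg_left (hfB a) hα.le)
    rw [ν.mean_const_mul] at h
    rw [Real.log_le_iff_le_exp hZpos, Real.exp_add]
    have : Z = Real.exp (α * ν.mean f)
        * ν.mean (fun a => Real.exp (α * f a - α * ν.mean f)) := by
      rw [← ν.mean_const_mul]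
      simp only [← Real.exp_add]
      rw [hZ]
      congr 1
      funext a
      congr 1
      ring
    rw [this]
    gcongr
  have hνf : ν.mean f ≤ μ.mean f + θ * B := by
    have hμ0 := μ.mean_nonneg hf0
    have : ν.mean f = (1 - θ) * μ.mean f + θ * (PMF.uniformOfFintype A).mean f := by
      simp only [PMF.mean, hνa, toReal_uniformOfFintype, Finset.mul_sum, ← Finset.sum_add_distrib]
      exact Finset.sum_congr rfl fun a _ => by ring
    have hu := (PMF.uniformOfFintype A).mean_le hfB
    rw [this]
    nlinarith
  simp only [hup]
  rw [q.mean_sub, q.mean_const, q.mean_const_mul]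
  nlinarith

/-- The mixture is at least `(1 - 1 / K) * p k a`, so the logarithms telescope up to a loss of at
most `1 / (K - 1)` per step. The first step starts from the uniform distribution, which mixing
preserves; it costs exactly `log |A|` and no loss, so the total loss is at most 1, and `K = 1` is
covered. -/
theorem sum_log_sub_log_mix_le {K : ℕ} (hK : 1 ≤ K) (p : ℕ → A → ℝ) (hp : ∀ k a, 0 < p k a)
    (hp1 : ∀ k a, p k a ≤ 1) (h0 : ∀ a, p 0 a = (Fintype.card A : ℝ)⁻¹) (a : A) :
    ∑ k ∈ Finset.range K, (Real.log (p (k + 1) a)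
      - Real.log ((1 - 1 / K) * p k a + 1 / K * (Fintype.card A : ℝ)⁻¹))
      ≤ Real.log (Fintype.card A) + 1 := by
  have hA : 0 < (Fintype.card A : ℝ)⁻¹ := inv_pos.2 (by exact_mod_cast Fintype.card_pos)
  have hind : ∀ n, n + 1 ≤ K → ∑ k ∈ Finset.range (n + 1), (Real.log (p (k + 1) a)
      - Real.log ((1 - 1 / K) * p k a + 1 / K * (Fintype.card A : ℝ)⁻¹))
      ≤ Real.log (Fintype.card A) + Real.log (p (n + 1) a) + n * (1 / (K - 1)) := by
    intro n
    induction n with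
    | zero =>
      intro _
      have : (1 - 1 / (K : ℝ)) * p 0 a + 1 / K * (Fintype.card A : ℝ)⁻¹
        = (Fintype.card A : ℝ)⁻¹ := by rw [h0]; ring
      rw [zero_add, Finset.sum_range_one, zero_add, this, Real.log_inv, Nat.cast_zero]
      linarith
    | succ n ih =>
      intro hn
      have hK2 : (2 : ℝ) ≤ K := by exact_mod_cast (by omega : 2 ≤ K)
      have hpos : 0 < 1 - 1 / (K : ℝ) := by
        rw [sub_pos, div_lt_one (by linarith)]
        linarith
      have h1 : Real.log (1 - 1 / K) + Real.log (p (n + 1) a)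
          ≤ Real.log ((1 - 1 / K) * p (n + 1) a + 1 / K * (Fintype.card A : ℝ)⁻¹) := by
        rw [← Real.log_mul hpos.ne' (hp _ _).ne']
        refine Real.log_le_log (mul_pos hpos (hp _ _)) ?_
        have : 0 ≤ 1 / (K : ℝ) * (Fintype.card A : ℝ)⁻¹ := by positivity
        linarith
      have h2 : -Real.log (1 - 1 / K) ≤ 1 / ((K : ℝ) - 1) := by
        rw [← Real.log_inv]
        refine (Real.log_le_sub_one_of_pos (inv_pos.2 hpos)).trans_eq ?_
        have : (K : ℝ) - 1 ≠ 0 := by linarith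
        have : (K : ℝ) ≠ 0 := by linarith
        have : (1 - 1 / (K : ℝ)) = (K - 1) / K := by field_simp
        rw [this, inv_div]
        field_simp
        ring
      rw [Finset.sum_range_succ]
      have := ih (by omega)
      push_cast
      linarith
  obtain ⟨n, rfl⟩ : ∃ n, K = n + 1 := ⟨K - 1, by omega⟩
  refine (hind n le_rfl).trans ?_
  have h1 : Real.log (p (n + 1) a) ≤ 0 := Real.log_nonpos (hp _ _).le (hp1 _ _)
  -- For `n = 0` this uses that division by zero gives zero.
  have h2 : (n : ℝ) * (1 / (((n + 1 : ℕ) : ℝ) - 1)) ≤ 1 := by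
    push_cast
    rw [add_sub_cancel_right, mul_one_div]
    exact div_self_le_one _
  linarith

/-- The regret of mirror descent from the uniform distribution, with uniform mixing of weight
`1 / K`, over `K` steps. -/
theorem mirrorDescent_regret_le {K : ℕ} (hK : 1 ≤ K) {α B : ℝ} (hα : 0 < α) (p : ℕ → PMF A)
    (f : ℕ → A → ℝ) (hf0 : ∀ k a, 0 ≤ f k a) (hfB : ∀ k a, f k a ≤ B)
    (h0 : p 0 = PMF.uniformOfFintype A)
    (hp : ∀ k, p (k + 1) = policyUpdate (1 / K) (p k) fun a => α * f k a) (q : PMF A) :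
    ∑ k ∈ Finset.range K, (q.mean (f k) - (p k).mean (f k))
      ≤ (Real.log (Fintype.card A) + 1) / α + B + K * α * B ^ 2 := by
  have hK' : (1 : ℝ) ≤ K := by exact_mod_cast hK
  have hA : 0 < (Fintype.card A : ℝ)⁻¹ := inv_pos.2 (by exact_mod_cast Fintype.card_pos)
  have hθ0 : (0 : ℝ) < 1 / K := by positivity
  have hθ1 : 1 / (K : ℝ) ≤ 1 := by rwa [div_le_one (by linarith)]
  have hpos : ∀ k a, 0 < (p k a).toReal := by
    intro k a
    cases k with
    | zero => rw [h0, toReal_uniformOfFintype]; exact hA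
    | succ k =>
      have hm : ∀ a, 0 < (1 - 1 / (K : ℝ)) * (p k a).toReal + 1 / K * (Fintype.card A : ℝ)⁻¹ :=
        fun a => by
          have : 0 ≤ (1 - 1 / (K : ℝ)) * (p k a).toReal :=
            mul_nonneg (by linarith) ENNReal.toReal_nonneg
          positivity
      rw [hp, toReal_policyUpdate hθ0.le hθ1]
      exact div_pos (mul_pos (hm a) (Real.exp_pos _)) (Finset.sum_pos
        (fun a _ => mul_pos (hm a) (Real.exp_pos _)) Finset.univ_nonempty)
  have hle1 : ∀ k a, (p k a).toReal ≤ 1 := fun k a =>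
    ENNReal.toReal_le_of_le_ofReal zero_le_one (by simpa using (p k).coe_le_one a)
  have hsum := Finset.sum_le_sum fun k (_ : k ∈ Finset.range K) =>
    mirrorDescent_step hθ0 hθ1 hα (p k) q (hf0 k) (hfB k)
  rw [← Finset.mul_sum, Finset.sum_add_distrib, ← PMF.mean_sum, Finset.sum_const,
    Finset.card_range, nsmul_eq_mul] at hsum
  have hq : q.mean (fun a => ∑ k ∈ Finset.range K,
      (Real.log (policyUpdate (1 / K) (p k) (fun a => α * f k a) a).toReal
        - Real.log ((1 - 1 / K) * (p k a).toReal + 1 / K * (Fintype.card A : ℝ)⁻¹)))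
      ≤ Real.log (Fintype.card A) + 1 := by
    refine q.mean_le fun a => ?_
    simp only [← hp]
    exact sum_log_sub_log_mix_le hK (fun k a => (p k a).toReal) hpos hle1
      (fun a => by rw [h0, toReal_uniformOfFintype]) a
  refine le_of_mul_le_mul_left ?_ hα
  refine hsum.trans ((add_le_add_left hq _).trans_eq ?_)
  field_simp
  ring

/-- The regret of projected gradient descent on `[0, χ]`. -/
theorem projectedGradient_regret_le {χ η b B y : ℝ} (hη : 0 < η) (hy : y ∈ Set.Icc 0 χ)
    (Y v : ℕ → ℝ) (hY0 : Y 0 = 0)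
    (hY : ∀ k, Y (k + 1) = max 0 (min χ (Y k + η * (b - v k)))) (hv : ∀ k, |b - v k| ≤ B) (n : ℕ) :
    ∑ k ∈ Finset.range n, (y - Y k) * (b - v k) ≤ y ^ 2 / (2 * η) + η * n * B ^ 2 / 2 := by
  -- Projection onto the interval does not increase the distance to its point `y`.
  have hproj : ∀ z : ℝ, (max 0 (min χ z) - y) ^ 2 ≤ (z - y) ^ 2 := fun z => by
    obtain ⟨h0, h1⟩ := hy
    rcases le_total χ z with h | h
    · rw [min_eq_left h, max_eq_right (h0.trans h1)]
      nlinarith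
    · rw [min_eq_right h]
      rcases le_total 0 z with h' | h'
      · rw [max_eq_right h']
      · rw [max_eq_left h']
        nlinarith
  have hind : 2 * η * ∑ k ∈ Finset.range n, (y - Y k) * (b - v k) + (Y n - y) ^ 2
      ≤ y ^ 2 + n * (η ^ 2 * B ^ 2) := by
    induction n with
    | zero => simp [hY0]
    | succ n ih =>
      have h1 := hproj (Y n + η * (b - v n))
      have h2 : (b - v n) ^ 2 ≤ B ^ 2 := sq_le_sq' (abs_le.1 (hv n)).1 (abs_le.1 (hv n)).2
      have h3 : η ^ 2 * (b - v n) ^ 2 ≤ η ^ 2 * B ^ 2 := by gcongr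
      rw [Finset.sum_range_succ, hY]
      push_cast
      nlinarith
  have h := hind
  have h4 := sq_nonneg (Y n - y)
  refine le_of_mul_le_mul_left (a := 2 * η) ?_ (by positivity)
  have : 2 * η * (y ^ 2 / (2 * η) + η * n * B ^ 2 / 2) = y ^ 2 + n * (η ^ 2 * B ^ 2) := by
    field_simp
  linarith

/-- Each occurrence contributes `1 / √(N + 1) ≤ 2 * (√(N + 1) - √N)`, where `N` counts the earlier
ones, and the right side telescopes. -/
theorem sum_ite_inv_sqrt_le (p : ℕ → Prop) [DecidablePred p] (n : ℕ) :
    ∑ k ∈ Finset.range n, (if p k then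
      1 / Real.sqrt ((∑ j ∈ Finset.range k, if p j then (1 : ℝ) else 0) + 1) else 0)
      ≤ 2 * Real.sqrt (∑ j ∈ Finset.range n, if p j then (1 : ℝ) else 0) := by
  induction n with
  | zero => simp
  | succ n ih =>
    rw [Finset.sum_range_succ, Finset.sum_range_succ]
    set N : ℝ := ∑ j ∈ Finset.range n, if p j then (1 : ℝ) else 0 with hN
    have hN0 : 0 ≤ N := Finset.sum_nonneg fun j _ => by split_ifs <;> norm_num
    by_cases h : p n
    · simp only [h, if_true]
      have h1 : 0 < Real.sqrt (N + 1) := Real.sqrt_pos.2 (by linarith)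
      have h2 : Real.sqrt (N + 1) ^ 2 = N + 1 := Real.sq_sqrt (by linarith)
      have h3 : Real.sqrt N ^ 2 = N := Real.sq_sqrt hN0
      have h4 : 2 * Real.sqrt N + 1 / Real.sqrt (N + 1) ≤ 2 * Real.sqrt (N + 1) := by
        refine le_of_mul_le_mul_left ?_ h1
        rw [mul_add, mul_one_div_cancel h1.ne']
        nlinarith [sq_nonneg (Real.sqrt (N + 1) - Real.sqrt N)]
      linarith
    · simp only [h, if_false, add_zero]
      exact ih

end OnlineLearning

/-! ### Transition counts and their deviation from the mean. -/

section Counts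

variable {S : Type u} {A : Type v} {H n : ℕ} [DecidableEq S] [DecidableEq A]

theorem estReward_eq (lam : ℝ) (f : ℕ → S → A → ℝ) (D : Fin n → Trajectory S A H) (h : Fin H)
    (x : S) (a : A) :
    estReward lam f D h x a = visits D h x a * f h x a / (visits D h x a + lam) := by
  rw [estReward]
  congr 1
  rw [visits, Nat.cast_sum, Finset.sum_mul]
  refine Finset.sum_congr rfl fun τ _ => ?_
  split_ifs with hτ
  · rw [hτ.1, hτ.2]
    simp
  · simp

theorem sum_visitsNext (D : Fin n → Trajectory S A H) (h : Fin H) (x : S) (a : A)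
    (U : Finset S) :
    ∑ x' ∈ U, (visitsNext D h x a x' : ℝ)
      = ∑ τ, if (D τ).1 h.castSucc = x ∧ (D τ).2 h = a then
          (if (D τ).1 h.succ ∈ U then (1 : ℝ) else 0) else 0 := by
  simp only [visitsNext, Nat.cast_sum]
  rw [Finset.sum_comm]
  refine Finset.sum_congr rfl fun τ _ => ?_
  by_cases h1 : (D τ).1 h.castSucc = x ∧ (D τ).2 h = a
  · simp [h1.1, h1.2]
  · rw [if_neg h1]
    refine Finset.sum_eq_zero fun x' _ => ?_
    rw [if_neg fun h2 => h1 ⟨h2.1, h2.2.1⟩, Nat.cast_zero]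

variable [Fintype S]

/-- The excess of the number of transitions from `(x, a)` into `U` at step `h` over its
conditional expectation. -/
noncomputable def excess (P : ℕ → S → A → PMF S) (D : Fin n → Trajectory S A H) (h : Fin H)
    (x : S) (a : A) (U : Finset S) : ℝ :=
  ∑ x' ∈ U, ((visitsNext D h x a x' : ℝ) - visits D h x a * (P h x a x').toReal)

theorem excess_eq_sum (P : ℕ → S → A → PMF S) (D : Fin n → Trajectory S A H) (h : Fin H)
    (x : S) (a : A) (U : Finset S) :
    excess P D h x a U = ∑ τ, if (D τ).1 h.castSucc = x ∧ (D τ).2 h = a then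
      (if (D τ).1 h.succ ∈ U then (1 : ℝ) else 0)
        - (P h x a).mean (fun x' => if x' ∈ U then 1 else 0) else 0 := by
  have hP : (P h x a).mean (fun x' => if x' ∈ U then 1 else 0)
      = ∑ x' ∈ U, (P h x a x').toReal := by
    simp [PMF.mean]
  rw [excess, Finset.sum_sub_distrib, sum_visitsNext, ← Finset.mul_sum, ← hP, visits,
    Nat.cast_sum, Finset.sum_mul, ← Finset.sum_sub_distrib]
  refine Finset.sum_congr rfl fun τ _ => ?_
  split_ifs <;> simp

theorem excess_univ (P : ℕ → S → A → PMF S) (D : Fin n → Trajectory S A H) (h : Fin H)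
    (x : S) (a : A) : excess P D h x a Finset.univ = 0 := by
  rw [excess_eq_sum]
  simp [PMF.mean_const]

/-- The deviations sum to zero over `S`, so their positive and negative parts have the same total,
namely the excess of the set `U` where they are nonnegative. Weights in `[0, B]` cannot give more
than `B` times this total. No independence of `V` from the data is needed. -/
theorem abs_sum_mul_visits_sub_le (P : ℕ → S → A → PMF S) (D : Fin n → Trajectory S A H)
    (h : Fin H) (x : S) (a : A) {ε B : ℝ} (hε : ∀ U, excess P D h x a U ≤ ε) {V : S → ℝ}
    (hV0 : ∀ x', 0 ≤ V x') (hVB : ∀ x', V x' ≤ B) :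
    |∑ x', V x' * ((visitsNext D h x a x' : ℝ) - visits D h x a * (P h x a x').toReal)|
      ≤ B * ε := by
  set w : S → ℝ := fun x' => (visitsNext D h x a x' : ℝ) - visits D h x a * (P h x a x').toReal
    with hw
  have hB : 0 ≤ B := (hV0 x).trans (hVB x)
  set U : Finset S := Finset.univ.filter fun x' => 0 ≤ w x' with hU
  have h1 : ∑ x' ∈ U, w x' ≤ ε := hε U
  have h2 : ∑ x' ∈ U, w x' + ∑ x' ∈ Uᶜ, w x' = 0 := by
    rw [Finset.sum_add_sum_compl]
    exact excess_univ P D h x a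
  have h3 := Finset.sum_add_sum_compl U fun x' => V x' * w x'
  have mU : ∀ x' ∈ U, 0 ≤ w x' := fun x' hx => (Finset.mem_filter.1 hx).2
  have mUc : ∀ x' ∈ Uᶜ, w x' ≤ 0 := fun x' hx => by
    rw [Finset.mem_compl, hU, Finset.mem_filter] at hx
    exact (not_le.1 fun h => hx ⟨Finset.mem_univ _, h⟩).le
  have a1 : ∑ x' ∈ U, V x' * w x' ≤ B * ∑ x' ∈ U, w x' := by
    rw [Finset.mul_sum]
    exact Finset.sum_le_sum fun x' hx => mul_le_mul_of_nonneg_right (hVB x') (mU x' hx)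
  have a2 : 0 ≤ ∑ x' ∈ U, V x' * w x' :=
    Finset.sum_nonneg fun x' hx => mul_nonneg (hV0 x') (mU x' hx)
  have a3 : ∑ x' ∈ Uᶜ, V x' * w x' ≤ 0 :=
    Finset.sum_nonpos fun x' hx => mul_nonpos_of_nonneg_of_nonpos (hV0 x') (mUc x' hx)
  have a4 : B * ∑ x' ∈ Uᶜ, w x' ≤ ∑ x' ∈ Uᶜ, V x' * w x' := by
    rw [Finset.mul_sum]
    exact Finset.sum_le_sum fun x' hx => mul_le_mul_of_nonpos_right (hVB x') (mUc x' hx)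
  have a5 : B * ∑ x' ∈ U, w x' ≤ B * ε := mul_le_mul_of_nonneg_left h1 hB
  have a6 : B * ∑ x' ∈ Uᶜ, w x' = -(B * ∑ x' ∈ U, w x') := by
    rw [eq_neg_of_add_eq_zero_right h2]; ring
  rw [abs_le]
  constructor <;> linarith

end Counts

/-! ### Optimism of the estimated action values. -/

section Estimation

variable {S : Type u} {A : Type v} {H n : ℕ} [Fintype S] [Fintype A] [DecidableEq S]
  [DecidableEq A]

theorem optQ_nonneg (lam β : ℝ) (f : ℕ → S → A → ℝ) (D : Fin n → Trajectory S A H)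
    (π : Policy S A) (h : ℕ) (x : S) (a : A) : 0 ≤ optQ lam β f D π h x a := by
  rw [optQ]
  split_ifs
  · exact le_max_right _ _
  · exact le_rfl

theorem optQ_le (lam β : ℝ) (f : ℕ → S → A → ℝ) (D : Fin n → Trajectory S A H)
    (π : Policy S A) {h : ℕ} (hh : h ≤ H) (x : S) (a : A) :
    optQ lam β f D π h x a ≤ (H : ℝ) - h := by
  have h0 : (0 : ℝ) ≤ (H : ℝ) - h := sub_nonneg.2 (by exact_mod_cast hh)
  rw [optQ]
  split_ifs
  · exact max_le (min_le_right _ _) h0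
  · exact h0

theorem optQ_horizon (lam β : ℝ) (f : ℕ → S → A → ℝ) (D : Fin n → Trajectory S A H)
    (π : Policy S A) : optQ lam β f D π H = 0 := by
  rw [optQ, dif_neg (lt_irrefl H)]

theorem optV_eq_mean (lam β : ℝ) (f : ℕ → S → A → ℝ) (D : Fin n → Trajectory S A H)
    (π : Policy S A) (h : ℕ) (x : S) :
    optV lam β f D π h x = (π h x).mean (optQ lam β f D π h x) :=
  Finset.sum_congr rfl fun _ _ => mul_comm _ _

/-- The optimistic action-value function dominates its Bellman backup, by at most four bonuses. -/
theorem optQ_sub_backup_mem (P : ℕ → S → A → PMF S) {f : ℕ → S → A → ℝ}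
    (hf : ∀ h < H, ∀ x a, f h x a ∈ Set.Icc (0 : ℝ) 1) (D : Fin n → Trajectory S A H)
    (π : Policy S A) {β ℓ : ℝ} (hβ : H * (2 * Real.sqrt ℓ + 1) ≤ 2 * β) {h : ℕ} (hh : h < H)
    (x : S) (a : A)
    (hD : ∀ U, excess P D ⟨h, hh⟩ x a U ≤ 2 * Real.sqrt (visits D ⟨h, hh⟩ x a * ℓ)) :
    optQ 1 β f D π h x a - (f h x a + (P h x a).mean fun x' =>
        (π (h + 1) x').mean (optQ 1 β f D π (h + 1) x'))
      ∈ Set.Icc 0 (min (4 * bonus 1 β D ⟨h, hh⟩ x a) H) := by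
  set V : S → ℝ := fun x' => (π (h + 1) x').mean (optQ 1 β f D π (h + 1) x') with hV
  have hV0 : ∀ x', 0 ≤ V x' := fun x' => PMF.mean_nonneg _ fun a => optQ_nonneg _ _ _ _ _ _ _ _
  have hVB : ∀ x', V x' ≤ (H : ℝ) - h - 1 := fun x' => PMF.mean_le _ fun a => by
    have := optQ_le 1 β f D π (Nat.succ_le_of_lt hh) x' a
    push_cast at this
    linarith
  have hh' : (h : ℝ) + 1 ≤ H := by exact_mod_cast hh
  have hh0 : (0 : ℝ) ≤ h := Nat.cast_nonneg _
  set N : ℝ := (visits D ⟨h, hh⟩ x a : ℝ) with hN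
  have hN0 : 0 ≤ N := Nat.cast_nonneg _
  have hsum := abs_sum_mul_visits_sub_le P D ⟨h, hh⟩ x a hD hV0 hVB
  have hQ : optQ 1 β f D π h x a = max (min (estReward 1 f D ⟨h, hh⟩ x a
      + ∑ x', estTransition 1 D ⟨h, hh⟩ x a x' * V x' + 2 * bonus 1 β D ⟨h, hh⟩ x a)
      ((H : ℝ) - h)) 0 := by
    rw [optQ, dif_pos hh]
    simp only [hV, PMF.mean, mul_comm (ENNReal.toReal _)]
  set PV : ℝ := (P h x a).mean V with hPV
  have hPV0 : 0 ≤ PV := PMF.mean_nonneg _ hV0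
  have hPVB : PV ≤ (H : ℝ) - h - 1 := PMF.mean_le _ hVB
  obtain ⟨hf0, hf1⟩ := hf h hh x a
  set W : ℝ := ∑ x', V x' * ((visitsNext D ⟨h, hh⟩ x a x' : ℝ) - N * (P h x a x').toReal) with hW
  -- The error splits into the transition noise `W` and a bias `-(f + PV)` caused by the
  -- regularization `lam = 1`, both divided by `N + 1`. In `hβ` the term `2 * √ℓ` pays for the noise
  -- and the term `1` for the bias.
  have hest : estReward 1 f D ⟨h, hh⟩ x a + ∑ x', estTransition 1 D ⟨h, hh⟩ x a x' * V x'
      = f h x a + PV + (W - (f h x a + PV)) / (N + 1) := by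
    have hsplit : W = ∑ x', (visitsNext D ⟨h, hh⟩ x a x' : ℝ) * V x' - N * PV := by
      rw [hW, hPV, PMF.mean, Finset.mul_sum, ← Finset.sum_sub_distrib]
      exact Finset.sum_congr rfl fun x' _ => by ring
    have : ∑ x', estTransition 1 D ⟨h, hh⟩ x a x' * V x'
        = (∑ x', (visitsNext D ⟨h, hh⟩ x a x' : ℝ) * V x') / (N + 1) := by
      rw [Finset.sum_div]
      exact Finset.sum_congr rfl fun x' _ => by rw [estTransition]; ring
    rw [estReward_eq, this, hsplit, ← hN]
    have : N + 1 ≠ 0 := by linarith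
    field_simp
    ring
  set b : ℝ := bonus 1 β D ⟨h, hh⟩ x a with hb
  have hbeq : b = β / Real.sqrt (N + 1) := rfl
  have hs1 : 1 ≤ Real.sqrt (N + 1) := Real.one_le_sqrt.2 (by linarith)
  have hs2 : Real.sqrt (N + 1) ^ 2 = N + 1 := Real.sq_sqrt (by linarith)
  have herr : |(W - (f h x a + PV)) / (N + 1)| ≤ 2 * b := by
    rw [abs_div, abs_of_pos (show 0 < N + 1 by linarith), hbeq, ← mul_div_assoc,
      div_le_div_iff₀ (by linarith) (by linarith)]
    have h1 : Real.sqrt (N * ℓ) ≤ Real.sqrt (N + 1) * Real.sqrt ℓ := by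
      rw [Real.sqrt_mul hN0]
      exact mul_le_mul_of_nonneg_right (Real.sqrt_le_sqrt (by linarith)) (Real.sqrt_nonneg _)
    have h2 : |W - (f h x a + PV)| ≤ H * ((2 * Real.sqrt ℓ + 1) * Real.sqrt (N + 1)) := by
      have h3 : |W - (f h x a + PV)| ≤ |W| + |f h x a + PV| := abs_sub _ _
      have h4 : |f h x a + PV| ≤ H := by
        rw [abs_of_nonneg (by linarith)]
        linarith
      have h5 : ((H : ℝ) - h - 1) * (2 * Real.sqrt (N * ℓ))
          ≤ H * (2 * (Real.sqrt (N + 1) * Real.sqrt ℓ)) := by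
        apply mul_le_mul <;> first | linarith | positivity
      have h6 : (H : ℝ) * 1 ≤ H * Real.sqrt (N + 1) := by gcongr
      nlinarith
    calc |W - (f h x a + PV)| * Real.sqrt (N + 1)
        ≤ H * ((2 * Real.sqrt ℓ + 1) * Real.sqrt (N + 1)) * Real.sqrt (N + 1) := by gcongr
      _ = H * (2 * Real.sqrt ℓ + 1) * (N + 1) := by linear_combination (H * (2 * Real.sqrt ℓ + 1)) * hs2
      _ ≤ 2 * β * (N + 1) := by gcongr
  have hb0 : 0 ≤ b := by
    have := (abs_nonneg _).trans herr
    linarith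
  obtain ⟨e1, e2⟩ := abs_le.1 herr
  rw [hQ, hest]
  -- Truncation keeps optimism because the true backup is itself at most `H - h`.
  refine ⟨sub_nonneg.2 ((le_min ?_ ?_).trans (le_max_left _ _)), le_min ?_ ?_⟩
  · linarith
  · linarith
  · rw [sub_le_iff_le_add]
    refine max_le ((min_le_left _ _).trans ?_) ?_ <;> linarith
  · rw [sub_le_iff_le_add]
    refine max_le ((min_le_right _ _).trans ?_) ?_ <;> linarith

end Estimation

/-! ### Exponential supermartingales along a run. -/

namespace TabularCMDP

variable {S : Type u} {A : Type v} {H : ℕ} [Fintype S] [Fintype A]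

theorem mean_trajectoryLaw_step (M : TabularCMDP S A H) (π : Policy S A) (h : Fin H)
    (φ : S → A → S → ℝ) :
    (M.trajectoryLaw π H).mean (fun t => φ (t.1 h.castSucc) (t.2 h) (t.1 h.succ))
      = ∑ x, M.occ π h x * (π h x).mean fun a => (M.P h x a).mean fun x' => φ x a x' := by
  have := M.mean_trajectoryLaw_sum π H fun h' x a x' => if h' = h then φ x a x' else 0
  simp only [Fin.val_inj, Finset.sum_ite_eq', Finset.mem_univ, if_true] at this
  rw [this, Finset.sum_eq_single (h : ℕ)]
  · simp
  · intro h' _ hne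
    simp [hne, PMF.mean_const]
  · simp

theorem mean_trajectoryLaw_step_le (M : TabularCMDP S A H) (π : Policy S A) (h : Fin H)
    {φ : S → A → S → ℝ} {c : ℝ} (hφ : ∀ x a, (M.P h x a).mean (φ x a) ≤ c) :
    (M.trajectoryLaw π H).mean (fun t => φ (t.1 h.castSucc) (t.2 h) (t.1 h.succ)) ≤ c := by
  rw [mean_trajectoryLaw_step]
  exact M.sum_occ_mul_le π h fun x => PMF.mean_le _ fun a => hφ x a

variable [DecidableEq S] [DecidableEq A]

/-- Given a visit to `(x, a)`, the next state has law `M.P h x a` whatever the policy; the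
compensator `lam ^ 2` absorbs the moment bound. Without a visit the exponent is zero. -/
theorem mean_trajectoryLaw_exp_excess_le_one (M : TabularCMDP S A H) (π : Policy S A)
    (h : Fin H) (x : S) (a : A) (U : Finset S) {lam : ℝ} (hlam : 0 ≤ lam) :
    (M.trajectoryLaw π H).mean (fun e => Real.exp (if e.1 h.castSucc = x ∧ e.2 h = a then
      lam * ((if e.1 h.succ ∈ U then 1 else 0)
        - (M.P h x a).mean fun x' => if x' ∈ U then 1 else 0) - lam ^ 2 else 0)) ≤ 1 := by
  refine M.mean_trajectoryLaw_step_le π h (φ := fun y b y' => Real.exp (if y = x ∧ b = a then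
      lam * ((if y' ∈ U then 1 else 0)
        - (M.P h x a).mean fun x' => if x' ∈ U then 1 else 0) - lam ^ 2 else 0)) fun y b => ?_
  by_cases hyb : y = x ∧ b = a
  · obtain ⟨rfl, rfl⟩ := hyb
    simp only [and_self, if_true]
    have := (M.P h y b).mean_exp_centred_le (f := fun x' => lam * if x' ∈ U then 1 else 0)
      (B := lam) (fun x' => by split_ifs <;> simp [hlam]) (fun x' => by split_ifs <;> simp [hlam])
    rw [PMF.mean_const_mul] at this
    simp only [sub_eq_add_neg _ (lam ^ 2), Real.exp_add, PMF.mean_mul_const, mul_sub]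
    calc _ ≤ Real.exp (lam ^ 2) * Real.exp (-lam ^ 2) := by gcongr
      _ = 1 := by rw [← Real.exp_add]; simp
  · simp [hyb, PMF.mean_const]

variable [Nonempty A]

/-- A product of factors whose conditional means are at most `1` has mean at most `1`. -/
theorem mean_runLaw_exp_sum_le_one (M : TabularCMDP S A H) (c : OPDOPParams)
    (f : (n : ℕ) → (Fin n → Trajectory S A H) → Trajectory S A H → ℝ)
    (hf : ∀ n D, (M.trajectoryLaw (M.opdop c n D).π H).mean (fun e => Real.exp (f n D e)) ≤ 1)
    (K : ℕ) :
    (M.runLaw c K).mean (fun ω => Real.exp (∑ k : Fin K,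
      f k (fun i => ω (Fin.castLE k.isLt.le i)) (ω k))) ≤ 1 := by
  induction K with
  | zero => simp [PMF.mean_const]
  | succ K ih =>
    rw [runLaw, PMF.mean_bind]
    -- Conditioning on the first `K` episodes: the earlier factors are constants and the last one
    -- has conditional mean at most 1.
    refine le_trans (PMF.mean_mono _ fun D => ?_) ih
    rw [PMF.mean_map]
    simp only [Fin.sum_univ_castSucc, Real.exp_add]
    have h1 : ∀ (e : Trajectory S A H) (k : Fin K),
        (fun i : Fin k => (Fin.snoc D e : Fin (K + 1) → Trajectory S A H)
          (Fin.castLE k.castSucc.isLt.le i)) = fun i => D (Fin.castLE k.isLt.le i) :=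
      fun e k => funext fun i =>
        Fin.snoc_castSucc (α := fun _ => Trajectory S A H) e D (Fin.castLE k.isLt.le i)
    have h2 : ∀ e : Trajectory S A H,
        (fun i : Fin K => (Fin.snoc D e : Fin (K + 1) → Trajectory S A H)
          (Fin.castLE (Fin.last K).isLt.le i)) = D :=
      fun e => funext fun i => Fin.snoc_castSucc (α := fun _ => Trajectory S A H) e D _
    have h3 : ∀ e : Trajectory S A H,
        Real.exp (∑ k : Fin K, f (k.castSucc : Fin (K + 1))
            (fun i => (Fin.snoc D e : Fin (K + 1) → Trajectory S A H)
              (Fin.castLE k.castSucc.isLt.le i))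
            ((Fin.snoc D e : Fin (K + 1) → Trajectory S A H) k.castSucc))
          * Real.exp (f (Fin.last K : Fin (K + 1))
            (fun i => (Fin.snoc D e : Fin (K + 1) → Trajectory S A H)
              (Fin.castLE (Fin.last K).isLt.le i))
            ((Fin.snoc D e : Fin (K + 1) → Trajectory S A H) (Fin.last K)))
        = Real.exp (∑ k : Fin K, f k (fun i => D (Fin.castLE k.isLt.le i)) (D k))
          * Real.exp (f K D e) := fun e => by
      congr 2
      · refine Finset.sum_congr rfl fun k _ => ?_
        have := h1 e k
        simp only [Fin.snoc_castSucc]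
        exact congrArg (fun D' => f k D' (D k)) this
      · rw [Fin.snoc_last]
        exact congrArg (fun D' => f K D' e) (h2 e)
    simp only [h3]
    rw [PMF.mean_const_mul]
    exact mul_le_of_le_one_right (Real.exp_pos _).le (hf K D)

end TabularCMDP

/-! ### The total uncertainty at the visited pairs. -/

section Uncertainty

variable {S : Type u} {A : Type v} {H n : ℕ} [DecidableEq S] [DecidableEq A]

/-- The bound on the one-step error of the optimistic action-value function. -/
noncomputable def uncertainty (β : ℝ) (D : Fin n → Trajectory S A H) (h : ℕ) (x : S) (a : A) : ℝ :=
  if hh : h < H then min (4 * bonus 1 β D ⟨h, hh⟩ x a) H else 0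

theorem uncertainty_nonneg {β : ℝ} (hβ : 0 ≤ β) (D : Fin n → Trajectory S A H) (h : ℕ) (x : S)
    (a : A) : 0 ≤ uncertainty β D h x a := by
  rw [uncertainty]
  split_ifs
  · exact le_min (mul_nonneg (by norm_num) (div_nonneg hβ (Real.sqrt_nonneg _)))
      (Nat.cast_nonneg _)
  · exact le_rfl

theorem uncertainty_le (β : ℝ) (D : Fin n → Trajectory S A H) (h : ℕ) (x : S) (a : A) :
    uncertainty β D h x a ≤ H := by
  rw [uncertainty]
  split_ifs
  · exact min_le_right _ _
  · exact Nat.cast_nonneg _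

theorem visits_prefix (W : ℕ → Trajectory S A H) (k : ℕ) (h : Fin H) (x : S) (a : A) :
    (visits (fun i : Fin k => W i) h x a : ℝ)
      = ∑ j ∈ Finset.range k, if (W j).1 h.castSucc = x ∧ (W j).2 h = a then (1 : ℝ) else 0 := by
  rw [visits, Nat.cast_sum, Finset.sum_range]
  exact Finset.sum_congr rfl fun i _ => by split_ifs <;> simp

variable [Fintype S] [Fintype A]

/-- The total uncertainty at the visited pairs. -/
theorem sum_uncertainty_le {β : ℝ} (hβ : 0 ≤ β) (W : ℕ → Trajectory S A H) (K : ℕ) :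
    ∑ k ∈ Finset.range K, ∑ h : Fin H,
        uncertainty β (fun i : Fin k => W i) h ((W k).1 h.castSucc) ((W k).2 h)
      ≤ 8 * β * H * Real.sqrt (Fintype.card S * Fintype.card A * K) := by
  have hN : ∀ h : Fin H, ∑ k ∈ Finset.range K,
      uncertainty β (fun i : Fin k => W i) h ((W k).1 h.castSucc) ((W k).2 h)
      ≤ 8 * β * Real.sqrt (Fintype.card S * Fintype.card A * K) := by
    intro h
    set p : S × A → ℕ → Prop := fun z j => (W j).1 h.castSucc = z.1 ∧ (W j).2 h = z.2 with hp
    set N : S × A → ℝ := fun z => ∑ j ∈ Finset.range K, if p z j then (1 : ℝ) else 0 with hNdef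
    have hN0 : ∀ z, 0 ≤ N z := fun z => Finset.sum_nonneg fun j _ => by split_ifs <;> norm_num
    -- Each episode visits exactly one pair at step `h`.
    have hNsum : ∑ z, N z = K := by
      rw [hNdef, Finset.sum_comm]
      have : ∀ j, ∑ z : S × A, (if p z j then (1 : ℝ) else 0) = 1 := fun j => by
        rw [Finset.sum_eq_single ((W j).1 h.castSucc, (W j).2 h)]
        · simp [hp]
        · intro z _ hz
          rw [if_neg]
          exact fun h' => hz (Prod.ext h'.1.symm h'.2.symm)
        · simp
      simp [this]
    have h1 : ∀ k, uncertainty β (fun i : Fin k => W i) h ((W k).1 h.castSucc) ((W k).2 h)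
        ≤ 4 * β * ∑ z, if p z k then
          1 / Real.sqrt ((∑ j ∈ Finset.range k, if p z j then (1 : ℝ) else 0) + 1) else 0 := by
      intro k
      rw [Finset.sum_eq_single ((W k).1 h.castSucc, (W k).2 h)]
      · rw [if_pos ⟨rfl, rfl⟩, uncertainty, dif_pos h.isLt]
        refine (min_le_left _ _).trans_eq ?_
        rw [bonus, visits_prefix]
        ring
      · intro z _ hz
        rw [if_neg]
        exact fun h' => hz (Prod.ext h'.1.symm h'.2.symm)
      · simp
    calc _ ≤ ∑ k ∈ Finset.range K, 4 * β * ∑ z, (if p z k then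
          1 / Real.sqrt ((∑ j ∈ Finset.range k, if p z j then (1 : ℝ) else 0) + 1) else 0) :=
          Finset.sum_le_sum fun k _ => h1 k
      _ = 4 * β * ∑ z, ∑ k ∈ Finset.range K, (if p z k then
          1 / Real.sqrt ((∑ j ∈ Finset.range k, if p z j then (1 : ℝ) else 0) + 1) else 0) := by
          rw [← Finset.mul_sum, Finset.sum_comm]
      _ ≤ 4 * β * ∑ z, 2 * Real.sqrt (N z) := by
          gcongr with z
          exact sum_ite_inv_sqrt_le (p z) K
      _ = 8 * β * ∑ z, Real.sqrt 1 * Real.sqrt (N z) := by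
          rw [← Finset.mul_sum, Real.sqrt_one]
          simp only [one_mul]
          ring
      -- Cauchy–Schwarz over the state-action pairs.
      _ ≤ 8 * β * (Real.sqrt (∑ z : S × A, 1) * Real.sqrt (∑ z, N z)) := by
          gcongr
          exact Real.sum_sqrt_mul_sqrt_le _ (fun _ => zero_le_one) hN0
      _ = _ := by
          rw [hNsum, ← Real.sqrt_mul (by positivity)]
          simp
  rw [Finset.sum_comm]
  calc _ ≤ ∑ h : Fin H, 8 * β * Real.sqrt (Fintype.card S * Fintype.card A * K) :=
        Finset.sum_le_sum fun h _ => hN h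
    _ = _ := by
        rw [Finset.sum_const, Finset.card_univ, Fintype.card_fin, nsmul_eq_mul]
        ring

end Uncertainty

/-! ### Duality and the Lagrangian regret decomposition. -/

namespace TabularCMDP

section Values

variable {S : Type u} {A : Type v} {H : ℕ} [Fintype S] [Fintype A]

theorem value_sub_le_of_optimistic (M : TabularCMDP S A H) (π ρ : Policy S A)
    (f Q : ℕ → S → A → ℝ) (hQ : Q H = 0)
    (hopt : ∀ h < H, ∀ x a, 0 ≤ Q h x a - (f h x a + (M.P h x a).mean fun x' =>
      (ρ (h + 1) x').mean (Q (h + 1) x'))) :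
    M.value f π - (ρ 0 M.x₁).mean (Q 0 M.x₁)
      ≤ ∑ h ∈ Finset.range H, ∑ x,
          M.occ π h x * ((π h x).mean (Q h x) - (ρ h x).mean (Q h x)) := by
  rw [M.value_sub_eq π ρ f Q hQ]
  exact sub_le_self _ <| Finset.sum_nonneg fun h hh => Finset.sum_nonneg fun x _ =>
    mul_nonneg (M.occ_nonneg π h x) (PMF.mean_nonneg _ fun a => hopt h (Finset.mem_range.1 hh) x a)

/-- The value difference identity along the evaluated policy itself: the policy term vanishes and
only Bellman errors remain. -/
theorem optimistic_sub_value_le (M : TabularCMDP S A H) (ρ : Policy S A)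
    (f Q u : ℕ → S → A → ℝ) (hQ : Q H = 0)
    (hu : ∀ h < H, ∀ x a, Q h x a - (f h x a + (M.P h x a).mean fun x' =>
      (ρ (h + 1) x').mean (Q (h + 1) x')) ≤ u h x a) :
    (ρ 0 M.x₁).mean (Q 0 M.x₁) - M.value f ρ
      ≤ ∑ h ∈ Finset.range H, ∑ x, M.occ ρ h x * (ρ h x).mean (u h x) := by
  rw [← neg_sub, M.value_sub_eq ρ ρ f Q hQ]
  simp only [sub_self, mul_zero, Finset.sum_const_zero, zero_sub, neg_neg]
  exact Finset.sum_le_sum fun h hh => Finset.sum_le_sum fun x _ =>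
    mul_le_mul_of_nonneg_left (PMF.mean_mono _ fun a => hu h (Finset.mem_range.1 hh) x a)
      (M.occ_nonneg ρ h x)

/-- A bound on the Lagrangian regret for the multiplier `2 * H / γ` bounds the constraint
violation. -/
theorem violation_le_of_lagrangian (M : TabularCMDP S A H) {γ : ℝ} (hγ : M.Slater γ)
    (hH : 0 < H) (hr : ∀ h < H, ∀ x a, M.r h x a ∈ Set.Icc (0 : ℝ) 1) {πstar : Policy S A}
    (hstar : M.IsOptimal πstar) {K : ℕ} (hK : 1 ≤ K) (π : Fin K → Policy S A) {R : ℝ} (hR : 0 ≤ R)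
    (hlag : ∑ k, (M.value M.r πstar - M.value M.r (π k))
      + 2 * H / γ * ∑ k, (M.b - M.value M.g (π k)) ≤ R) :
    max (∑ k, (M.b - M.value M.g (π k))) 0 ≤ γ / H * R := by
  obtain ⟨hγ0, πbar, hbar⟩ := hγ
  have hH' : (0 : ℝ) < H := by exact_mod_cast hH
  have hK' : (0 : ℝ) < K := by exact_mod_cast hK
  set v := ∑ k, (M.b - M.value M.g (π k)) with hv
  refine max_le ?_ (by positivity)
  rcases le_or_gt v 0 with hv0 | hv0
  · exact hv0.trans (by positivity)
  have hden : 0 < v + K * γ := by positivity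
  -- The Slater policy gets weight proportional to `v`, each played policy weight proportional to
  -- `γ`. The utility then is at least `(v * (b + γ) + γ * (K * b - v)) / (v + K * γ) = b`: the
  -- slack `γ` pays exactly for the violation.
  obtain ⟨π', hπ'⟩ := M.exists_mixture
    (fun o : Option (Fin K) => o.elim (v / (v + K * γ)) fun _ => γ / (v + K * γ))
    (fun o => by cases o <;> simp <;> positivity)
    (by
      rw [Fintype.sum_option]
      simp only [Option.elim, Finset.sum_const, Finset.card_univ, Fintype.card_fin, nsmul_eq_mul]
      field_simp)
    (fun o => o.elim πbar π)
  have hval : ∀ f, (v + K * γ) * M.value f π'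
      = v * M.value f πbar + γ * ∑ k, M.value f (π k) := fun f => by
    rw [hπ', Fintype.sum_option]
    simp only [Option.elim, ← Finset.mul_sum]
    field_simp
  have hvg : v = K * M.b - ∑ k, M.value M.g (π k) := by
    rw [hv, Finset.sum_sub_distrib]
    simp
  have hfeas : M.b ≤ M.value M.g π' := by
    refine le_of_mul_le_mul_left ?_ hden
    rw [hval]
    nlinarith [mul_le_mul_of_nonneg_left hbar hv0.le]
  -- Optimality gives that `γ` times the reward regret is at least `-v * H`. Against the `2 * H * v`
  -- from the multiplier `2 * H / γ`, a net `H * v ≤ γ * R` remains.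
  have hopt := hstar.2 π' hfeas
  have hr1 := mul_le_mul_of_nonneg_left hopt hden.le
  rw [hval] at hr1
  have hbar0 := mul_nonneg hv0.le (M.value_nonneg πbar hr)
  have hstarH := mul_le_mul_of_nonneg_left (M.value_le πstar hr) hv0.le
  rw [Finset.sum_sub_distrib, Finset.sum_const, Finset.card_univ, Fintype.card_fin,
    nsmul_eq_mul] at hlag
  have hlag' := mul_le_mul_of_nonneg_left hlag hγ0.le
  have : γ * (2 * H / γ * v) = 2 * (H * v) := by field_simp
  rw [div_mul_eq_mul_div, le_div_iff₀ hH']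
  nlinarith

end Values

variable {S : Type u} {A : Type v} {H : ℕ} [Fintype S] [Fintype A] [DecidableEq S] [DecidableEq A]
  [Nonempty A]

/-- The state of the algorithm in the episode with index `k`, from an infinite sequence of
trajectories. -/
noncomputable def opdopRun (M : TabularCMDP S A H) (c : OPDOPParams) (W : ℕ → Trajectory S A H)
    (k : ℕ) : OPDOPState S A :=
  M.opdop c k fun i : Fin k => W i

theorem opdopRun_Qr (M : TabularCMDP S A H) (c : OPDOPParams) (W : ℕ → Trajectory S A H)
    (k : ℕ) : (M.opdopRun c W k).Qr
      = optQ c.lam c.β M.r (fun i : Fin k => W i) (M.opdopRun c W k).π := by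
  cases k <;> rfl

theorem opdopRun_Qg (M : TabularCMDP S A H) (c : OPDOPParams) (W : ℕ → Trajectory S A H)
    (k : ℕ) : (M.opdopRun c W k).Qg
      = optQ c.lam c.β M.g (fun i : Fin k => W i) (M.opdopRun c W k).π := by
  cases k <;> rfl

theorem opdopRun_Vg₁ (M : TabularCMDP S A H) (c : OPDOPParams) (W : ℕ → Trajectory S A H)
    (k : ℕ) : (M.opdopRun c W k).Vg₁
      = ((M.opdopRun c W k).π 0 M.x₁).mean ((M.opdopRun c W k).Qg 0 M.x₁) := by
  cases k <;> exact optV_eq_mean _ _ _ _ _ _ _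

theorem opdopRun_Y_mem (M : TabularCMDP S A H) (c : OPDOPParams) (hχ : 0 ≤ c.χ)
    (W : ℕ → Trajectory S A H) (k : ℕ) : (M.opdopRun c W k).Y ∈ Set.Icc 0 c.χ := by
  cases k <;> exact ⟨le_max_left _ _, max_le hχ (min_le_left _ _)⟩

/-- The initial value `Vg₁ = b` makes the first dual update void. -/
theorem opdopRun_Y_zero (M : TabularCMDP S A H) (c : OPDOPParams) (hχ : 0 ≤ c.χ)
    (W : ℕ → Trajectory S A H) : (M.opdopRun c W 0).Y = 0 := by
  change max 0 (min c.χ (0 + c.η * (M.b - M.b))) = 0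
  simp [hχ]

theorem opdopRun_π_zero (M : TabularCMDP S A H) (c : OPDOPParams) (h0 : 0 ≤ c.θ) (h1 : c.θ ≤ 1)
    (W : ℕ → Trajectory S A H) (h : ℕ) (x : S) :
    (M.opdopRun c W 0).π h x = PMF.uniformOfFintype A := by
  change policyUpdate c.θ (PMF.uniformOfFintype A) (fun a => c.α * (0 + 0 * 0)) = _
  simp only [mul_zero, add_zero]
  exact policyUpdate_uniform h0 h1

/-- The expected total uncertainty of the policies of a run. -/
noncomputable def expectedUncertainty (M : TabularCMDP S A H) (c : OPDOPParams)
    (W : ℕ → Trajectory S A H) (k : ℕ) : ℝ :=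
  ∑ h ∈ Finset.range H, ∑ x, M.occ (M.opdopRun c W k).π h x *
    ((M.opdopRun c W k).π h x).mean (uncertainty c.β (fun i : Fin k => W i) h x)

/-- The comparator `y` is free so that one bound serves both conclusions. Feasibility of `πstar` and
`Y ≥ 0` allow the dual term `Y * (b - Vg₁)` to be absorbed into the mirror descent regret for `Qr +
Y * Qg`; what is left is the dual regret against `y`. -/
theorem lagrangian_regret_le (M : TabularCMDP S A H) (c : OPDOPParams)
    (W : ℕ → Trajectory S A H) {K : ℕ} (hK : 1 ≤ K) (hα : 0 < c.α) (hη : 0 < c.η) (hχ : 0 ≤ c.χ)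
    (hθ : c.θ = 1 / K)
    (hest : ∀ k < K, ∀ f : ℕ → S → A → ℝ, (∀ h < H, ∀ x a, f h x a ∈ Set.Icc (0 : ℝ) 1) →
      ∀ h < H, ∀ x a, optQ c.lam c.β f (fun i : Fin k => W i) (M.opdopRun c W k).π h x a
        - (f h x a + (M.P h x a).mean fun x' => ((M.opdopRun c W k).π (h + 1) x').mean
          (optQ c.lam c.β f (fun i : Fin k => W i) (M.opdopRun c W k).π (h + 1) x'))
        ∈ Set.Icc 0 (uncertainty c.β (fun i : Fin k => W i) h x a))
    {πstar : Policy S A} (hstar : M.b ≤ M.value M.g πstar) {y : ℝ} (hy : y ∈ Set.Icc 0 c.χ) :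
    ∑ k ∈ Finset.range K, (M.value M.r πstar - M.value M.r (M.opdopRun c W k).π)
      + y * ∑ k ∈ Finset.range K, (M.b - M.value M.g (M.opdopRun c W k).π)
      ≤ H * ((Real.log (Fintype.card A) + 1) / c.α + H * (1 + c.χ)
          + K * c.α * (H * (1 + c.χ)) ^ 2)
        + (y ^ 2 / (2 * c.η) + c.η * K * H ^ 2 / 2)
        + (1 + y) * ∑ k ∈ Finset.range K, M.expectedUncertainty c W k := by
  set s := M.opdopRun c W with hs
  have hK' : (1 : ℝ) ≤ K := by exact_mod_cast hK
  have hθ0 : 0 ≤ c.θ := by rw [hθ]; positivity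
  have hθ1 : c.θ ≤ 1 := by rw [hθ]; exact (div_le_one (by linarith)).2 hK'
  have hYmem : ∀ k, (s k).Y ∈ Set.Icc 0 c.χ := M.opdopRun_Y_mem c hχ W
  have hQr : ∀ k, (s k).Qr = optQ c.lam c.β M.r (fun i : Fin k => W i) (s k).π := M.opdopRun_Qr c W
  have hQg : ∀ k, (s k).Qg = optQ c.lam c.β M.g (fun i : Fin k => W i) (s k).π := M.opdopRun_Qg c W
  have hQ0 : ∀ k h x a, 0 ≤ (s k).Qr h x a ∧ 0 ≤ (s k).Qg h x a := fun k h x a => by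
    rw [hQr, hQg]
    exact ⟨optQ_nonneg _ _ _ _ _ _ _ _, optQ_nonneg _ _ _ _ _ _ _ _⟩
  have hQH : ∀ k, ∀ h ≤ H, ∀ x a, (s k).Qr h x a ≤ H ∧ (s k).Qg h x a ≤ H := fun k h hh x a => by
    have hh0 : (0 : ℝ) ≤ h := Nat.cast_nonneg _
    rw [hQr, hQg]
    exact ⟨(optQ_le _ _ _ _ _ hh _ _).trans (by linarith),
      (optQ_le _ _ _ _ _ hh _ _).trans (by linarith)⟩
  -- mirror descent
  have hMD : ∑ k ∈ Finset.range K, ∑ h ∈ Finset.range H, ∑ x, M.occ πstar h x *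
      ((πstar h x).mean (fun a => (s k).Qr h x a + (s k).Y * (s k).Qg h x a)
        - ((s k).π h x).mean (fun a => (s k).Qr h x a + (s k).Y * (s k).Qg h x a))
      ≤ H * ((Real.log (Fintype.card A) + 1) / c.α + H * (1 + c.χ)
          + K * c.α * (H * (1 + c.χ)) ^ 2) := by
    have hx : ∀ h ∈ Finset.range H, ∀ x, ∑ k ∈ Finset.range K,
        ((πstar h x).mean (fun a => (s k).Qr h x a + (s k).Y * (s k).Qg h x a)
          - ((s k).π h x).mean (fun a => (s k).Qr h x a + (s k).Y * (s k).Qg h x a))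
        ≤ (Real.log (Fintype.card A) + 1) / c.α + H * (1 + c.χ)
          + K * c.α * (H * (1 + c.χ)) ^ 2 := by
      intro h hh x
      refine mirrorDescent_regret_le hK hα (fun k => (s k).π h x)
        (fun k a => (s k).Qr h x a + (s k).Y * (s k).Qg h x a) (fun k a => ?_) (fun k a => ?_)
        (M.opdopRun_π_zero c hθ0 hθ1 W h x) (fun k => ?_) (πstar h x)
      · exact add_nonneg (hQ0 k h x a).1 (mul_nonneg (hYmem k).1 (hQ0 k h x a).2)
      · have h1 := hQH k h (Finset.mem_range.1 hh).le x a
        have h2 : (s k).Y * (s k).Qg h x a ≤ c.χ * H :=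
          mul_le_mul (hYmem k).2 h1.2 (hQ0 k h x a).2 hχ
        linarith [h1.1]
      · rw [← hθ]
        rfl
    -- The occupancies are those of `πstar`, which do not depend on `k`, so the sum over episodes
    -- moves inside and mirror descent applies at each `(h, x)` separately.
    rw [Finset.sum_comm]
    simp only [Finset.sum_comm (s := Finset.range K) (t := (Finset.univ : Finset S)),
      ← Finset.mul_sum]
    calc _ ≤ ∑ h ∈ Finset.range H, ((Real.log (Fintype.card A) + 1) / c.α + H * (1 + c.χ)
          + K * c.α * (H * (1 + c.χ)) ^ 2) :=
          Finset.sum_le_sum fun h hh => M.sum_occ_mul_le πstar h (hx h hh)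
      _ = _ := by rw [Finset.sum_const, Finset.card_range, nsmul_eq_mul]
  -- the dual variable
  have hV0 : ∀ k, 0 ≤ (s k).Vg₁ ∧ (s k).Vg₁ ≤ H := fun k => by
    have : (s k).Vg₁ = ((s k).π 0 M.x₁).mean ((s k).Qg 0 M.x₁) := M.opdopRun_Vg₁ c W k
    rw [this]
    exact ⟨PMF.mean_nonneg _ fun a => (hQ0 k _ _ a).2,
      PMF.mean_le _ fun a => (hQH k 0 (Nat.zero_le _) _ a).2⟩
  have hdual := projectedGradient_regret_le (B := H) hη hy (fun k => (s k).Y) (fun k => (s k).Vg₁)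
    (M.opdopRun_Y_zero c hχ W) (b := M.b) (fun k => rfl)
    (fun k => abs_le.2 ⟨by linarith [(hV0 k).2, M.b_mem.1], by linarith [(hV0 k).1, M.b_mem.2]⟩) K
  -- one episode
  have hep : ∀ k ∈ Finset.range K, (M.value M.r πstar - M.value M.r (s k).π)
      + y * (M.b - M.value M.g (s k).π)
      ≤ (∑ h ∈ Finset.range H, ∑ x, M.occ πstar h x *
        ((πstar h x).mean (fun a => (s k).Qr h x a + (s k).Y * (s k).Qg h x a)
          - ((s k).π h x).mean (fun a => (s k).Qr h x a + (s k).Y * (s k).Qg h x a)))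
        + (y - (s k).Y) * (M.b - (s k).Vg₁) + (1 + y) * M.expectedUncertainty c W k := by
    intro k hk
    have er := hest k (Finset.mem_range.1 hk) M.r M.r_mem
    have eg := hest k (Finset.mem_range.1 hk) M.g M.g_mem
    rw [← hQr] at er
    rw [← hQg] at eg
    have zr : (s k).Qr H = 0 := by rw [hQr]; exact optQ_horizon _ _ _ _ _
    have zg : (s k).Qg H = 0 := by rw [hQg]; exact optQ_horizon _ _ _ _ _
    have r1 := M.value_sub_le_of_optimistic πstar (s k).π M.r (s k).Qr zr
      fun h hh x a => (er h hh x a).1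
    have g1 := M.value_sub_le_of_optimistic πstar (s k).π M.g (s k).Qg zg
      fun h hh x a => (eg h hh x a).1
    have r2 := M.optimistic_sub_value_le (s k).π M.r (s k).Qr _ zr
      fun h hh x a => (er h hh x a).2
    have g2 := M.optimistic_sub_value_le (s k).π M.g (s k).Qg _ zg
      fun h hh x a => (eg h hh x a).2
    have hV : (s k).Vg₁ = ((s k).π 0 M.x₁).mean ((s k).Qg 0 M.x₁) := M.opdopRun_Vg₁ c W k
    rw [← hV] at g1 g2
    have hE : M.expectedUncertainty c W k = ∑ h ∈ Finset.range H, ∑ x, M.occ (s k).π h x *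
      ((s k).π h x).mean (uncertainty c.β (fun i : Fin k => W i) h x) := rfl
    rw [← hE] at r2 g2
    have hsplit : (∑ h ∈ Finset.range H, ∑ x, M.occ πstar h x *
        ((πstar h x).mean (fun a => (s k).Qr h x a + (s k).Y * (s k).Qg h x a)
          - ((s k).π h x).mean (fun a => (s k).Qr h x a + (s k).Y * (s k).Qg h x a)))
        = (∑ h ∈ Finset.range H, ∑ x,
          M.occ πstar h x * ((πstar h x).mean ((s k).Qr h x) - ((s k).π h x).mean ((s k).Qr h x)))
          + (s k).Y * ∑ h ∈ Finset.range H, ∑ x,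
          M.occ πstar h x * ((πstar h x).mean ((s k).Qg h x)
            - ((s k).π h x).mean ((s k).Qg h x)) := by
      simp only [PMF.mean_add, PMF.mean_const_mul, Finset.mul_sum, ← Finset.sum_add_distrib]
      exact Finset.sum_congr rfl fun h _ => Finset.sum_congr rfl fun x _ => by ring
    rw [hsplit]
    have t1 := mul_le_mul_of_nonneg_left g1 (hYmem k).1
    have t2 := mul_le_mul_of_nonneg_left g2 hy.1
    have t3 := mul_le_mul_of_nonneg_left hstar (hYmem k).1
    nlinarith
  have hsum := Finset.sum_le_sum hep
  rw [Finset.sum_add_distrib, Finset.sum_add_distrib, Finset.sum_add_distrib, ← Finset.mul_sum,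
    ← Finset.mul_sum] at hsum
  linarith



/-! ### The concentration events. -/

section Extend

variable {S : Type u} {A : Type v} {H : ℕ} [Nonempty A]

/-- An infinite sequence of trajectories that starts with the run `ω`. -/
noncomputable def extendRun (M : TabularCMDP S A H) {K : ℕ} (ω : Fin K → Trajectory S A H) :
    ℕ → Trajectory S A H :=
  fun i => if hi : i < K then ω ⟨i, hi⟩ else (fun _ => M.x₁, fun _ => Classical.arbitrary A)

theorem extendRun_prefix (M : TabularCMDP S A H) {K : ℕ} (ω : Fin K → Trajectory S A H)
    (k : Fin K) : (fun i : Fin k => M.extendRun ω i) = fun i => ω (Fin.castLE k.isLt.le i) :=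
  funext fun i => dif_pos (i.isLt.trans k.isLt)

theorem extendRun_apply (M : TabularCMDP S A H) {K : ℕ} (ω : Fin K → Trajectory S A H)
    (k : Fin K) : M.extendRun ω k = ω k :=
  dif_pos k.isLt

end Extend

variable {S : Type u} {A : Type v} {H : ℕ} [Fintype S] [DecidableEq S] [DecidableEq A]

/-- The optimal tilt `√(ℓ / N)` depends on the random count `N`, so the exponential bound is assumed
for all tilts `√(ℓ / (m + 1))` and read off at `m + 1 = N`. With no visits the excess is an empty
sum. -/
theorem excess_prefix_le (P : ℕ → S → A → PMF S) (W : ℕ → Trajectory S A H) {k K : ℕ}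
    (hk : k < K) (h : Fin H) (x : S) (a : A) (U : Finset S) {ℓ : ℝ} (hℓ : 0 < ℓ)
    (hZ : ∀ m : Fin K, Real.sqrt (ℓ / (m + 1)) * excess P (fun i : Fin k => W i) h x a U
      - Real.sqrt (ℓ / (m + 1)) ^ 2 * visits (fun i : Fin k => W i) h x a ≤ ℓ) :
    excess P (fun i : Fin k => W i) h x a U
      ≤ 2 * Real.sqrt (visits (fun i : Fin k => W i) h x a * ℓ) := by
  set D : Fin k → Trajectory S A H := fun i => W i with hD
  rcases Nat.eq_zero_or_pos (visits D h x a) with h0 | h0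
  · have : excess P D h x a U = 0 := by
      rw [excess_eq_sum]
      rw [visits, Finset.sum_eq_zero_iff] at h0
      refine Finset.sum_eq_zero fun τ hτ => if_neg fun hc => ?_
      have := h0 τ hτ
      simp [hc] at this
    rw [this]
    positivity
  · have hle : visits D h x a ≤ k := by
      calc visits D h x a ≤ ∑ τ : Fin k, 1 :=
            Finset.sum_le_sum fun τ _ => by split_ifs <;> simp
        _ = k := by simp
    have hm := hZ ⟨visits D h x a - 1, by omega⟩
    have hcast : (((visits D h x a - 1 : ℕ) : ℝ) + 1) = visits D h x a := by
      rw [Nat.cast_sub h0]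
      simp
    simp only [hcast] at hm
    set N : ℝ := (visits D h x a : ℝ) with hN
    have hN0 : 0 < N := Nat.cast_pos.2 h0
    rw [Real.sq_sqrt (by positivity), div_mul_cancel₀ _ hN0.ne'] at hm
    have hs : 0 < Real.sqrt (ℓ / N) := Real.sqrt_pos.2 (by positivity)
    refine le_of_mul_le_mul_left ?_ hs
    have : Real.sqrt (ℓ / N) * (2 * Real.sqrt (N * ℓ)) = 2 * ℓ := by
      rw [mul_left_comm, ← Real.sqrt_mul (by positivity),
        show ℓ / N * (N * ℓ) = ℓ ^ 2 by field_simp, Real.sqrt_sq hℓ.le]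
    linarith

/-- The guard `j < k` freezes the supermartingale after `k` episodes, so that the state after any
prefix is a sum over all `K` episodes. -/
theorem sum_guarded_increment (P : ℕ → S → A → PMF S) (W : ℕ → Trajectory S A H) {k K : ℕ}
    (hk : k < K) (h : Fin H) (x : S) (a : A) (U : Finset S) (lam : ℝ) :
    ∑ j ∈ Finset.range K, (if j < k then if (W j).1 h.castSucc = x ∧ (W j).2 h = a then
      lam * ((if (W j).1 h.succ ∈ U then 1 else 0)
        - (P h x a).mean fun x' => if x' ∈ U then 1 else 0) - lam ^ 2 else 0 else 0)
      = lam * excess P (fun i : Fin k => W i) h x a U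
        - lam ^ 2 * visits (fun i : Fin k => W i) h x a := by
  rw [← Finset.sum_filter]
  have : (Finset.range K).filter (· < k) = Finset.range k := by
    ext j
    simp only [Finset.mem_filter, Finset.mem_range]
    omega
  rw [this, excess_eq_sum, visits_prefix, Finset.sum_range, Finset.mul_sum, Finset.mul_sum,
    Finset.sum_range, ← Finset.sum_sub_distrib]
  refine Finset.sum_congr rfl fun j _ => ?_
  split_ifs <;> ring

variable [Fintype A]

theorem mean_trajectoryLaw_uncertainty (M : TabularCMDP S A H) (π : Policy S A) (β : ℝ) {n : ℕ}
    (D : Fin n → Trajectory S A H) :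
    (M.trajectoryLaw π H).mean (fun e => ∑ h : Fin H,
      uncertainty β D h (e.1 h.castSucc) (e.2 h))
      = ∑ h ∈ Finset.range H, ∑ x, M.occ π h x * (π h x).mean (uncertainty β D h x) := by
  have := M.mean_trajectoryLaw_sum π H fun h x a _ => uncertainty β D h x a
  simp only [PMF.mean_const] at this
  exact this

variable [Nonempty A]

theorem playedPolicy_eq (M : TabularCMDP S A H) (c : OPDOPParams) {K : ℕ}
    (ω : Fin K → Trajectory S A H) (k : Fin K) :
    M.playedPolicy c ω k = (M.opdopRun c (M.extendRun ω) k).π := by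
  rw [opdopRun, extendRun_prefix]
  rfl

/-- The total of a family of adapted increments along a run, as an exponential moment. -/
theorem mean_runLaw_exp_extendRun_le_one (M : TabularCMDP S A H) (c : OPDOPParams)
    (f : (n : ℕ) → (Fin n → Trajectory S A H) → Trajectory S A H → ℝ)
    (hf : ∀ n D, (M.trajectoryLaw (M.opdop c n D).π H).mean (fun e => Real.exp (f n D e)) ≤ 1)
    (K : ℕ) :
    (M.runLaw c K).mean (fun ω => Real.exp (∑ k ∈ Finset.range K,
      f k (fun i : Fin k => M.extendRun ω i) (M.extendRun ω k))) ≤ 1 := by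
  refine le_of_eq_of_le ?_ (M.mean_runLaw_exp_sum_le_one c f hf K)
  congr 1
  funext ω
  rw [Finset.sum_range]
  simp only [extendRun_prefix, extendRun_apply]

/-- The two events on which the regret is bounded fail together with probability at most `p`. -/
theorem exists_dominating (M : TabularCMDP S A H) (hH : 0 < H) (c : OPDOPParams) (hβ : 0 ≤ c.β)
    {K : ℕ} (hK : 1 ≤ K) {p : ℝ} (hp : 0 < p) :
    ∃ G : (Fin K → Trajectory S A H) → ℝ, (∀ ω, 0 ≤ G ω) ∧ (M.runLaw c K).mean G ≤ p ∧
      ∀ ω, G ω < 1 →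
        (∀ k < K, ∀ (h : Fin H) (x : S) (a : A) (U : Finset S), ∀ m : Fin K,
          Real.sqrt (Real.log (2 * (K ^ 2 * H * Fintype.card S * Fintype.card A
              * 2 ^ Fintype.card S) / p) / (m + 1))
              * excess M.P (fun i : Fin k => M.extendRun ω i) h x a U
            - Real.sqrt (Real.log (2 * (K ^ 2 * H * Fintype.card S * Fintype.card A
              * 2 ^ Fintype.card S) / p) / (m + 1)) ^ 2
              * visits (fun i : Fin k => M.extendRun ω i) h x a
            ≤ Real.log (2 * (K ^ 2 * H * Fintype.card S * Fintype.card A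
              * 2 ^ Fintype.card S) / p)) ∧
        ∑ k ∈ Finset.range K, M.expectedUncertainty c (M.extendRun ω) k
          ≤ 2 * (∑ k ∈ Finset.range K, ∑ h : Fin H,
              uncertainty c.β (fun i : Fin k => M.extendRun ω i) h
                ((M.extendRun ω k).1 h.castSucc) ((M.extendRun ω k).2 h)
            + H ^ 2 * Real.log (2 / p)) := by
  have hS : Nonempty S := ⟨M.x₁⟩
  have hH' : (0 : ℝ) < H := by exact_mod_cast hH
  have hK' : (0 : ℝ) < K := by exact_mod_cast hK
  have hS' : (0 : ℝ) < Fintype.card S := by exact_mod_cast Fintype.card_pos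
  have hA' : (0 : ℝ) < Fintype.card A := by exact_mod_cast Fintype.card_pos
  -- The number of indices of the union bound: prefix length, tilt, step, state, action and subset
  -- of `S`.
  set N : ℝ := K ^ 2 * H * Fintype.card S * Fintype.card A * 2 ^ Fintype.card S with hN
  have hN0 : 0 < N := by positivity
  set ℓ : ℝ := Real.log (2 * N / p) with hℓ
  let inc : (Fin K × Fin K × Fin H × S × A × Finset S) → (n : ℕ) →
      (Fin n → Trajectory S A H) → Trajectory S A H → ℝ := fun z n _ e =>
    if n < z.1 then if e.1 z.2.2.1.castSucc = z.2.2.2.1 ∧ e.2 z.2.2.1 = z.2.2.2.2.1 then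
      Real.sqrt (ℓ / (z.2.1 + 1)) * ((if e.1 z.2.2.1.succ ∈ z.2.2.2.2.2 then 1 else 0)
        - (M.P z.2.2.1 z.2.2.2.1 z.2.2.2.2.1).mean fun x' => if x' ∈ z.2.2.2.2.2 then 1 else 0)
        - Real.sqrt (ℓ / (z.2.1 + 1)) ^ 2 else 0 else 0
  -- Each of the `H` uncertainties is capped at `H`, so dividing by `H ^ 2` puts the total in `[0,
  -- 1]`.
  let X : (n : ℕ) → (Fin n → Trajectory S A H) → Trajectory S A H → ℝ := fun n D e =>
    1 / (H : ℝ) ^ 2 * ∑ h : Fin H, uncertainty c.β D h (e.1 h.castSucc) (e.2 h)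
  let ev : (n : ℕ) → (Fin n → Trajectory S A H) → Trajectory S A H → ℝ := fun n D e =>
    (M.trajectoryLaw (M.opdop c n D).π H).mean (X n D) / 2 - X n D e
  have hinc : ∀ z, (M.runLaw c K).mean (fun ω => Real.exp (∑ k ∈ Finset.range K,
      inc z k (fun i : Fin k => M.extendRun ω i) (M.extendRun ω k))) ≤ 1 := fun z => by
    refine M.mean_runLaw_exp_extendRun_le_one c (inc z) (fun n D => ?_) K
    by_cases hn : n < z.1
    · simp only [inc, if_pos hn]
      exact M.mean_trajectoryLaw_exp_excess_le_one _ _ _ _ _ (Real.sqrt_nonneg _)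
    · simp only [inc, if_neg hn, Real.exp_zero, PMF.mean_const, le_refl]
  have hev : (M.runLaw c K).mean (fun ω => Real.exp (∑ k ∈ Finset.range K,
      ev k (fun i : Fin k => M.extendRun ω i) (M.extendRun ω k))) ≤ 1 := by
    refine M.mean_runLaw_exp_extendRun_le_one c ev (fun n D => ?_) K
    refine PMF.mean_exp_half_mean_sub_le _ (fun e => ?_) (fun e => ?_)
    · exact mul_nonneg (by positivity) (Finset.sum_nonneg fun h _ => uncertainty_nonneg hβ _ _ _ _)
    · have : ∑ h : Fin H, uncertainty c.β D h (e.1 h.castSucc) (e.2 h) ≤ ∑ h : Fin H, (H : ℝ) :=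
        Finset.sum_le_sum fun h _ => uncertainty_le _ _ _ _ _
      rw [Finset.sum_const, Finset.card_univ, Fintype.card_fin, nsmul_eq_mul] at this
      simp only [X]
      rw [one_div_mul_eq_div, div_le_one (by positivity)]
      linarith
  -- A sum of nonnegative terms below 1 has every term below 1, hence every exponent negative. Each
  -- of the two families takes `p / 2` of the failure probability.
  refine ⟨fun ω => ∑ z, Real.exp (∑ k ∈ Finset.range K,
      inc z k (fun i : Fin k => M.extendRun ω i) (M.extendRun ω k)) * Real.exp (-ℓ)
      + Real.exp (∑ k ∈ Finset.range K,
      ev k (fun i : Fin k => M.extendRun ω i) (M.extendRun ω k)) * Real.exp (-Real.log (2 / p)),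
    fun ω => by positivity, ?_, fun ω hω => ⟨?_, ?_⟩⟩
  · rw [PMF.mean_add, PMF.mean_sum, PMF.mean_mul_const]
    simp only [PMF.mean_mul_const]
    have hcard : (Fintype.card (Fin K × Fin K × Fin H × S × A × Finset S) : ℝ) = N := by
      simp only [Fintype.card_prod, Fintype.card_fin, Fintype.card_finset]
      push_cast
      rw [hN]
      ring
    have e1 : Real.exp (-ℓ) = p / (2 * N) := by
      rw [Real.exp_neg, hℓ, Real.exp_log (by positivity), inv_div]
    have e2 : Real.exp (-Real.log (2 / p)) = p / 2 := by
      rw [Real.exp_neg, Real.exp_log (by positivity), inv_div]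
    have h1 : ∑ z, (M.runLaw c K).mean (fun ω => Real.exp (∑ k ∈ Finset.range K,
        inc z k (fun i : Fin k => M.extendRun ω i) (M.extendRun ω k))) * Real.exp (-ℓ)
        ≤ ∑ z : Fin K × Fin K × Fin H × S × A × Finset S, p / (2 * N) :=
      Finset.sum_le_sum fun z _ => by
        rw [e1]
        exact mul_le_of_le_one_left (by positivity) (hinc z)
    rw [Finset.sum_const, Finset.card_univ, nsmul_eq_mul, hcard] at h1
    have h2 : N * (p / (2 * N)) = p / 2 := by field_simp
    have h3 := mul_le_of_le_one_left (Real.exp_pos (-Real.log (2 / p))).le hev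
    rw [e2] at h3
    rw [e2]
    linarith
  · intro k hk h x a U m
    have h1 := (Finset.single_le_sum (f := fun z => Real.exp (∑ k ∈ Finset.range K,
      inc z k (fun i : Fin k => M.extendRun ω i) (M.extendRun ω k)) * Real.exp (-ℓ))
      (fun z _ => by positivity)
      (Finset.mem_univ ((⟨k, hk⟩, m, h, x, a, U) : Fin K × Fin K × Fin H × S × A × Finset S)))
    have h2 : 0 ≤ Real.exp (∑ k ∈ Finset.range K,
      ev k (fun i : Fin k => M.extendRun ω i) (M.extendRun ω k))
        * Real.exp (-Real.log (2 / p)) := by positivity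
    have h3 := (h1.trans (le_add_of_nonneg_right h2)).trans_lt hω
    rw [← Real.exp_add, Real.exp_lt_one_iff] at h3
    have h4 := sum_guarded_increment M.P (M.extendRun ω) hk h x a U (Real.sqrt (ℓ / (m + 1)))
    rw [← h4]
    have h5 := (add_neg_lt_iff_lt_add.1 h3).le
    rw [zero_add] at h5
    exact h5
  · have h1 : 0 ≤ ∑ z, Real.exp (∑ k ∈ Finset.range K,
      inc z k (fun i : Fin k => M.extendRun ω i) (M.extendRun ω k)) * Real.exp (-ℓ) := by positivity
    have h3 := (le_add_of_nonneg_left h1).trans_lt hω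
    rw [← Real.exp_add, Real.exp_lt_one_iff] at h3
    have h4 : ∀ k, ev k (fun i : Fin k => M.extendRun ω i) (M.extendRun ω k)
        = 1 / (2 * (H : ℝ) ^ 2) * (M.expectedUncertainty c (M.extendRun ω) k
          - 2 * ∑ h : Fin H, uncertainty c.β (fun i : Fin k => M.extendRun ω i) h
                ((M.extendRun ω k).1 h.castSucc) ((M.extendRun ω k).2 h)) := fun k => by
      simp only [ev, X]
      rw [PMF.mean_const_mul, mean_trajectoryLaw_uncertainty]
      change 1 / (H : ℝ) ^ 2 * M.expectedUncertainty c (M.extendRun ω) k / 2 - _ = _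
      field_simp
    simp only [h4] at h3
    rw [← Finset.mul_sum, Finset.sum_sub_distrib, ← Finset.mul_sum, ← sub_eq_add_neg, sub_neg,
      one_div_mul_eq_div, div_lt_iff₀ (by positivity)] at h3
    linarith

end TabularCMDP

/-! ### Numerical estimates. -/

/-- The contribution of the estimation errors to the regret bound. -/
theorem mul_uncertainty_le {s a H K p L E y z t κ : ℝ} (hs : 1 ≤ s)
    (hL0 : (0.69 : ℝ) ≤ L) (hz1 : 1 ≤ z) (hz2 : z ^ 2 = a) (ht1 : 1 ≤ t) (ht2 : t ^ 2 = K)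
    (hLp : Real.log (2 / p) ≤ L) (hy0 : 0 ≤ y) (hy : 1 + y ≤ 2 * H * κ)
    (hE : E ≤ 2 * (8 * (3 * H * Real.sqrt (s * L)) * H * Real.sqrt (s * a * K)
      + H ^ 2 * Real.log (2 / p))) :
    (1 + y) * E ≤ 124 * (κ * (H ^ 3 * (s * z * t * L))) := by
  have hsqL : Real.sqrt L ≤ 1.25 * L := by
    rw [Real.sqrt_le_left (by linarith)]
    nlinarith only [hL0]
  have hszt : 1 ≤ s * z * t :=
    one_le_mul_of_one_le_of_one_le (one_le_mul_of_one_le_of_one_le hs hz1) ht1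
  set w := s * z * t with hw
  have h1 : Real.sqrt (s * L) * Real.sqrt (s * a * K) ≤ 1.25 * (w * L) := by
    have e1 : Real.sqrt (s * L) * Real.sqrt (s * a * K) = w * Real.sqrt L := by
      rw [← Real.sqrt_mul (by nlinarith),
        show s * L * (s * a * K) = w ^ 2 * L by rw [hw, ← hz2, ← ht2]; ring,
        Real.sqrt_mul (by positivity), Real.sqrt_sq (by linarith)]
    rw [e1]
    calc w * Real.sqrt L ≤ w * (1.25 * L) := by gcongr
      _ = 1.25 * (w * L) := by ring
  have h2 : Real.log (2 / p) ≤ w * L := hLp.trans (le_mul_of_one_le_left (by linarith) hszt)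
  have h3 : E ≤ 62 * (H ^ 2 * (w * L)) := by
    have h4 : 8 * (3 * H * Real.sqrt (s * L)) * H * Real.sqrt (s * a * K)
        = 24 * (H ^ 2 * (Real.sqrt (s * L) * Real.sqrt (s * a * K))) := by ring
    have h5 := mul_le_mul_of_nonneg_left h1 (sq_nonneg H)
    have h6 := mul_le_mul_of_nonneg_left h2 (sq_nonneg H)
    linarith only [hE, h4, h5, h6]
  calc (1 + y) * E ≤ (1 + y) * (62 * (H ^ 2 * (w * L))) := by gcongr
    _ ≤ 2 * H * κ * (62 * (H ^ 2 * (w * L))) := by gcongr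
    _ = 124 * (κ * (H ^ 3 * (w * L))) := by ring

/-- The terms of the regret bound, in the scale of the final estimate. Here `s`, `a` are the numbers
of states and actions, and `L` is the logarithm of the final estimate. -/
theorem regret_terms_le {s a H K γ p L E y : ℝ} (hs : 1 ≤ s) (ha : 2 ≤ a) (hH : 1 ≤ H)
    (hK : 1 ≤ K) (hγ : 0 < γ) (hL2 : Real.log 2 ≤ L) (hLa : Real.log a ≤ L)
    (hLp : Real.log (2 / p) ≤ L) (hy0 : 0 ≤ y) (hy : y ≤ 2 * H / γ)
    (hE : E ≤ 2 * (8 * (3 * H * Real.sqrt (s * L)) * H * Real.sqrt (s * a * K)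
      + H ^ 2 * Real.log (2 / p))) :
    H * ((Real.log a + 1) / (Real.sqrt (Real.log a) / (H ^ 2 * Real.sqrt K))
        + H * (1 + 2 * H / γ)
        + K * (Real.sqrt (Real.log a) / (H ^ 2 * Real.sqrt K)) * (H * (1 + 2 * H / γ)) ^ 2)
      + (y ^ 2 / (2 * (1 / Real.sqrt K)) + 1 / Real.sqrt K * K * H ^ 2 / 2) + (1 + y) * E
      ≤ 200 * (1 + 1 / γ) ^ 2 * s * Real.sqrt (a * H ^ 5 * (H * K)) * L := by
  have hlog2 := Real.log_two_gt_d9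
  have hloga : Real.log 2 ≤ Real.log a := Real.log_le_log (by norm_num) ha
  set q := Real.sqrt (Real.log a) with hq
  have hq2 : q ^ 2 = Real.log a := Real.sq_sqrt (by linarith)
  have hq8 : (4 / 5 : ℝ) ≤ q := Real.le_sqrt_of_sq_le (by norm_num; linarith)
  set t := Real.sqrt K with ht
  have ht2 : t ^ 2 = K := Real.sq_sqrt (by linarith)
  have ht1 : 1 ≤ t := Real.one_le_sqrt.2 hK
  set z := Real.sqrt a with hz
  have hz2 : z ^ 2 = a := Real.sq_sqrt (by linarith)
  have hz1 : 1 ≤ z := Real.one_le_sqrt.2 (by linarith)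
  set κ := 1 + 1 / γ with hκ
  have hγi : 0 < 1 / γ := by positivity
  have hκ1 : 1 ≤ κ := by linarith
  have hroot : Real.sqrt (a * H ^ 5 * (H * K)) = z * H ^ 3 * t := by
    rw [show a * H ^ 5 * (H * K) = (z * H ^ 3 * t) ^ 2 by rw [mul_pow, mul_pow, hz2, ht2]; ring]
    exact Real.sqrt_sq (by positivity)
  have hL0 : (0.69 : ℝ) ≤ L := by linarith
  set R := s * z * t * L with hR
  have hst : t ≤ s * z * t := by
    have h1 : 1 ≤ s * z := one_le_mul_of_one_le_of_one_le hs hz1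
    exact le_mul_of_one_le_left (by linarith) h1
  have htL : t * L ≤ R := by
    rw [hR]
    gcongr
  have htL0 : t ≤ 1.5 * R := by
    have := mul_le_mul_of_nonneg_left hL0 (show 0 ≤ t by linarith)
    linarith
  have hqL : q ≤ 1.25 * L := by nlinarith
  have hχ : 1 + 2 * H / γ ≤ 2 * H * κ := by
    rw [hκ, mul_add, mul_one_div]
    linarith
  have hκ2 : κ ≤ κ ^ 2 := by nlinarith
  have hH3 : 0 ≤ H ^ 3 := by positivity
  have hR0 : 0 ≤ R := by positivity
  have hH23 : H ^ 2 ≤ H ^ 3 := pow_le_pow_right₀ hH (by norm_num)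
  have hF : 0 ≤ H ^ 3 * R := by positivity
  have hFκ : H ^ 3 * R ≤ κ ^ 2 * (H ^ 3 * R) := le_mul_of_one_le_left hF (one_le_pow₀ hκ1)
  have htq : t * q ≤ 1.25 * R := by
    linarith [mul_le_mul_of_nonneg_left hqL (show 0 ≤ t by linarith)]
  clear_value R κ z t q
  have T1 : H * ((Real.log a + 1) / (q / (H ^ 2 * t))) ≤ 4 * (H ^ 3 * R) := by
    have h1 : H * ((Real.log a + 1) / (q / (H ^ 2 * t))) = H ^ 3 * (t * (q + 1 / q)) := by
      rw [← hq2]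
      have : q ≠ 0 := by linarith
      field_simp
    have h2 : 1 / q ≤ 1.25 := by
      rw [div_le_iff₀ (by linarith)]
      linarith
    have h3 : t * (q + 1 / q) ≤ 4 * R := by
      calc t * (q + 1 / q) ≤ t * (4 * L) := by gcongr; linarith
        _ ≤ 4 * R := by linarith
    rw [h1]
    linarith [mul_le_mul_of_nonneg_left h3 hH3]
  have T2 : H * (H * (1 + 2 * H / γ)) ≤ 3 * (κ ^ 2 * (H ^ 3 * R)) := by
    calc H * (H * (1 + 2 * H / γ)) ≤ H * (H * (2 * H * κ)) := by gcongr
      _ = 2 * (κ * (H ^ 3 * 1)) := by ring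
      _ ≤ 2 * (κ ^ 2 * (H ^ 3 * (1.5 * R))) := by gcongr; linarith
      _ = _ := by ring
  have T3 : H * (K * (q / (H ^ 2 * t)) * (H * (1 + 2 * H / γ)) ^ 2)
      ≤ 5 * (κ ^ 2 * (H ^ 3 * R)) := by
    calc H * (K * (q / (H ^ 2 * t)) * (H * (1 + 2 * H / γ)) ^ 2)
        ≤ H * (K * (q / (H ^ 2 * t)) * (H * (2 * H * κ)) ^ 2) := by gcongr
      _ = 4 * (κ ^ 2 * (H ^ 3 * (t * q))) := by
          rw [← ht2]
          field_simp
          ring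
      _ ≤ 4 * (κ ^ 2 * (H ^ 3 * (1.25 * R))) := by
          gcongr
      _ = _ := by ring
  have T4 : y ^ 2 / (2 * (1 / t)) ≤ 3 * (κ ^ 2 * (H ^ 3 * R)) := by
    calc y ^ 2 / (2 * (1 / t)) = y ^ 2 * t / 2 := by field_simp
      _ ≤ (2 * H * κ) ^ 2 * t / 2 := by
          have : y ≤ 2 * H * κ := by linarith
          gcongr
      _ = 2 * (κ ^ 2 * (H ^ 2 * t)) := by ring
      _ ≤ 2 * (κ ^ 2 * (H ^ 3 * (1.5 * R))) := by gcongr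
      _ = _ := by ring
  have T5 : 1 / t * K * H ^ 2 / 2 ≤ H ^ 3 * R := by
    calc 1 / t * K * H ^ 2 / 2 = 1 / 2 * (H ^ 2 * t) := by rw [← ht2]; field_simp
      _ ≤ 1 / 2 * (H ^ 3 * (1.5 * R)) := by gcongr
      _ ≤ H ^ 3 * R := by linarith
  have hyκ : 1 + y ≤ 2 * H * κ := by linarith
  have T6 := mul_uncertainty_le (H := H) hs hL0 hz1 hz2 ht1 ht2 hLp
    hy0 hyκ hE
  rw [← hR] at T6
  have T6' : 124 * (κ * (H ^ 3 * R)) ≤ 124 * (κ ^ 2 * (H ^ 3 * R)) := by gcongr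
  have hgoal : 200 * κ ^ 2 * s * (z * H ^ 3 * t) * L = 200 * (κ ^ 2 * (H ^ 3 * R)) := by
    rw [hR]
    ring
  rw [hroot, hgoal, mul_add, mul_add]
  -- The constants add up to `4 + 3 + 5 + 3 + 1 + 124 = 140`.
  linarith only [T1, T2, T3, T4, T5, T6, T6', hFκ, hF]

/-- This fixes `C₁ = 3`. The logarithm of the union bound is at most `4 * nS * L`, with `nS * log 2`
coming from the subsets, so twice its root is at most `4 * √(nS * L)`; the bias term 1 is at most `2
* √(nS * L)`. -/
theorem bonus_factor_bound {H K p : ℝ} {nS nA : ℕ} (hS : 1 ≤ nS) (hA : 2 ≤ nA) (hH : 1 ≤ H)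
    (hK : 1 ≤ K) (hp0 : 0 < p) (hp1 : p < 1) :
    0 < Real.log (2 * (K ^ 2 * H * nS * nA * 2 ^ nS) / p) ∧
    H * (2 * Real.sqrt (Real.log (2 * (K ^ 2 * H * nS * nA * 2 ^ nS) / p)) + 1)
      ≤ 2 * (3 * H * Real.sqrt (nS * Real.log (nS * nA * (H * K) / p))) := by
  have hS' : (1 : ℝ) ≤ nS := by exact_mod_cast hS
  have hA' : (2 : ℝ) ≤ nA := by exact_mod_cast hA
  have hlog2 := Real.log_two_gt_d9
  set L := Real.log (nS * nA * (H * K) / p) with hL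
  set X := nS * nA * (H * K) / p with hX
  have hX2 : 2 ≤ X := by
    rw [hX, le_div_iff₀ hp0]
    have h1 : (1 : ℝ) * 2 ≤ nS * nA := by gcongr
    have h2 : 1 ≤ H * K := one_le_mul_of_one_le_of_one_le hH hK
    nlinarith
  have hL2 : Real.log 2 ≤ L := Real.log_le_log (by norm_num) hX2
  have hle : 2 * (K ^ 2 * H * nS * nA * 2 ^ nS) / p ≤ 2 * 2 ^ nS * X ^ 2 := by
    have : 2 * (K ^ 2 * H * nS * nA * 2 ^ nS) / p
        = 2 * 2 ^ nS * (K ^ 2 * H * nS * nA / p) := by ring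
    rw [this]
    have h1 : K ^ 2 * H * nS * nA / p * 1 ≤ K ^ 2 * H * nS * nA / p * (H * nS * nA / p) := by
      gcongr
      rw [le_div_iff₀ hp0, one_mul]
      have h1 : (1 : ℝ) * 1 * 1 ≤ H * nS * nA := by gcongr; linarith
      linarith
    have h2 : K ^ 2 * H * nS * nA / p * (H * nS * nA / p) = X ^ 2 := by
      rw [hX]
      ring
    rw [← h2]
    gcongr
    linarith
  have hone : 1 < 2 * (K ^ 2 * H * nS * nA * 2 ^ nS) / p := by
    rw [lt_div_iff₀ hp0]
    have h1 : (1 : ℝ) ^ 2 * 1 * 1 * 2 * 1 ≤ K ^ 2 * H * nS * nA * 2 ^ nS := by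
      gcongr
      exact one_le_pow₀ one_le_two
    linarith
  refine ⟨Real.log_pos hone, ?_⟩
  have hsL : L ≤ nS * L := le_mul_of_one_le_left (by linarith) hS'
  have hℓ : Real.log (2 * (K ^ 2 * H * nS * nA * 2 ^ nS) / p) ≤ 2 ^ 2 * (nS * L) := by
    refine (Real.log_le_log (by linarith) hle).trans ?_
    rw [Real.log_mul (by positivity) (by positivity), Real.log_mul (by positivity) (by positivity),
      Real.log_pow, Real.log_pow]
    have : (nS : ℝ) * Real.log 2 ≤ nS * L := by gcongr
    push_cast
    linarith
  have h1 : Real.sqrt (Real.log (2 * (K ^ 2 * H * nS * nA * 2 ^ nS) / p))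
      ≤ 2 * Real.sqrt (nS * L) := by
    refine (Real.sqrt_le_sqrt hℓ).trans_eq ?_
    rw [Real.sqrt_mul (by positivity), Real.sqrt_sq (by norm_num)]
  have h2 : (1 / 2 : ℝ) ≤ Real.sqrt (nS * L) := Real.le_sqrt_of_sq_le (by norm_num; linarith)
  nlinarith

/-! ### The single-action case and the conclusion. -/

theorem PMF.subsingleton_of_subsingleton {α : Type*} [Fintype α] [Subsingleton α] :
    Subsingleton (PMF α) :=
  ⟨fun q q' => by
    ext a
    have hu : ∀ q : PMF α, q a = 1 := fun q => by
      rw [← q.tsum_coe, tsum_eq_single a fun b hb => (hb (Subsingleton.elim b a)).elim]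
    rw [hu q, hu q']⟩

namespace TabularCMDP

theorem horizon_pos {S : Type u} {A : Type v} {H : ℕ} (M : TabularCMDP S A H) : 0 < H := by
  have := M.b_mem.1.trans_le M.b_mem.2
  exact_mod_cast this

variable {S : Type u} {A : Type v} {H : ℕ} [Fintype S] [Fintype A]

theorem Slater.le_horizon {M : TabularCMDP S A H} {γ : ℝ} (h : M.Slater γ) : γ ≤ H := by
  obtain ⟨_, π, hπ⟩ := h
  linarith [M.value_le π M.g_mem, M.b_mem.1]

variable [DecidableEq S] [DecidableEq A] [Nonempty A]

/-- The regret and the violation on the event where the estimates are accurate. -/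
theorem regret_and_violation_le (M : TabularCMDP S A H) {K : ℕ} (hK : 1 ≤ K)
    (hA : 2 ≤ Fintype.card A) {γ : ℝ} (hγ : M.Slater γ) {πstar : Policy S A}
    (hstar : M.IsOptimal πstar) {p : ℝ} (hp : p ∈ Set.Ioo (0 : ℝ) 1)
    (ω : Fin K → Trajectory S A H)
    (hconc : ∀ k < K, ∀ (h : Fin H) (x : S) (a : A) (U : Finset S), ∀ m : Fin K,
          Real.sqrt (Real.log (2 * (K ^ 2 * H * Fintype.card S * Fintype.card A
              * 2 ^ Fintype.card S) / p) / (m + 1))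
              * excess M.P (fun i : Fin k => M.extendRun ω i) h x a U
            - Real.sqrt (Real.log (2 * (K ^ 2 * H * Fintype.card S * Fintype.card A
              * 2 ^ Fintype.card S) / p) / (m + 1)) ^ 2
              * visits (fun i : Fin k => M.extendRun ω i) h x a
            ≤ Real.log (2 * (K ^ 2 * H * Fintype.card S * Fintype.card A
              * 2 ^ Fintype.card S) / p))
    (hE : ∑ k ∈ Finset.range K, M.expectedUncertainty
        (tabularParams 3 (Fintype.card S) (Fintype.card A) H K γ p) (M.extendRun ω) k
          ≤ 2 * (∑ k ∈ Finset.range K, ∑ h : Fin H,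
              uncertainty (tabularParams 3 (Fintype.card S) (Fintype.card A) H K γ p).β
                (fun i : Fin k => M.extendRun ω i) h
                ((M.extendRun ω k).1 h.castSucc) ((M.extendRun ω k).2 h)
            + H ^ 2 * Real.log (2 / p))) :
    M.regret (tabularParams 3 (Fintype.card S) (Fintype.card A) H K γ p) πstar ω ≤
        200 * (1 + 1 / γ) ^ 2 * Fintype.card S * Real.sqrt (Fintype.card A * H ^ 5 * (H * K))
          * Real.log (Fintype.card S * Fintype.card A * (H * K) / p) ∧
    M.violation (tabularParams 3 (Fintype.card S) (Fintype.card A) H K γ p) ω ≤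
        400 * (1 + 1 / γ) * Fintype.card S * Real.sqrt (Fintype.card A * H ^ 5 * (H * K))
          * Real.log (Fintype.card S * Fintype.card A * (H * K) / p) := by
  obtain ⟨hp0, hp1⟩ := hp
  have hγ0 := hγ.1
  have hH := M.horizon_pos
  have hS : 1 ≤ Fintype.card S := Fintype.card_pos_iff.2 ⟨M.x₁⟩
  have hH' : (1 : ℝ) ≤ H := by exact_mod_cast hH
  have hK' : (1 : ℝ) ≤ K := by exact_mod_cast hK
  have hS' : (1 : ℝ) ≤ Fintype.card S := by exact_mod_cast hS
  have hA' : (2 : ℝ) ≤ Fintype.card A := by exact_mod_cast hA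
  have hlog2 := Real.log_two_gt_d9
  set c := tabularParams 3 (Fintype.card S) (Fintype.card A) H K γ p with hc
  set L := Real.log (Fintype.card S * Fintype.card A * (H * K) / p) with hL
  set W := M.extendRun ω with hW
  have hsa : (1 : ℝ) * 2 ≤ Fintype.card S * Fintype.card A := by gcongr
  have hHK : (1 : ℝ) ≤ H * K := one_le_mul_of_one_le_of_one_le hH' hK'
  have hmono : ∀ z : ℝ, 0 < z → z ≤ Fintype.card S * Fintype.card A * (H * K) / p →
    Real.log z ≤ L := fun z h0 h => Real.log_le_log h0 h
  have hLp : Real.log (2 / p) ≤ L := hmono _ (by positivity) (by gcongr; nlinarith)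
  have hLa : Real.log (Fintype.card A) ≤ L := hmono _ (by linarith) (by
    rw [le_div_iff₀ hp0]
    have h1 : (1 : ℝ) * Fintype.card A * 1 ≤ Fintype.card S * Fintype.card A * (H * K) := by
      gcongr
    nlinarith)
  have hloga : Real.log 2 ≤ Real.log (Fintype.card A) := Real.log_le_log (by norm_num) hA'
  have hL2 := hloga.trans hLa
  obtain ⟨hℓ, hβ⟩ := bonus_factor_bound hS hA hH' hK' hp0 hp1
  have hβ0 : 0 ≤ c.β := mul_nonneg (mul_nonneg (by norm_num) (by linarith)) (Real.sqrt_nonneg _)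
  have hest : ∀ k < K, ∀ f : ℕ → S → A → ℝ, (∀ h < H, ∀ x a, f h x a ∈ Set.Icc (0 : ℝ) 1) →
      ∀ h < H, ∀ x a, optQ c.lam c.β f (fun i : Fin k => W i) (M.opdopRun c W k).π h x a
        - (f h x a + (M.P h x a).mean fun x' => ((M.opdopRun c W k).π (h + 1) x').mean
          (optQ c.lam c.β f (fun i : Fin k => W i) (M.opdopRun c W k).π (h + 1) x'))
        ∈ Set.Icc 0 (uncertainty c.β (fun i : Fin k => W i) h x a) := by
    intro k hk f hf h hh x a
    rw [uncertainty, dif_pos hh]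
    exact optQ_sub_backup_mem M.P hf _ _ hβ hh x a fun U =>
      excess_prefix_le M.P W hk ⟨h, hh⟩ x a U hℓ (hconc k hk ⟨h, hh⟩ x a U)
  have hα : 0 < c.α := div_pos (Real.sqrt_pos.2 (by linarith)) (by positivity)
  have hη : 0 < c.η := by
    change 0 < 1 / Real.sqrt K
    positivity
  have hχ : 0 ≤ c.χ := by
    change 0 ≤ 2 * (H : ℝ) / γ
    positivity
  have hEbound := hE.trans (mul_le_mul_of_nonneg_left
    (add_le_add_left (sum_uncertainty_le hβ0 W K) _) (by norm_num))
  have hlag : ∀ y ∈ Set.Icc 0 c.χ,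
      ∑ k : Fin K, (M.value M.r πstar - M.value M.r (M.playedPolicy c ω k))
        + y * ∑ k : Fin K, (M.b - M.value M.g (M.playedPolicy c ω k))
      ≤ 200 * (1 + 1 / γ) ^ 2 * Fintype.card S
        * Real.sqrt (Fintype.card A * H ^ 5 * (H * K)) * L := by
    intro y hy
    have h1 := M.lagrangian_regret_le c W hK hα hη hχ rfl hest hstar.1 hy
    rw [Finset.sum_range, Finset.sum_range] at h1
    simp only [playedPolicy_eq]
    exact h1.trans (regret_terms_le hS' hA' hH' hK' hγ0 hL2 hLa hLp hy.1 hy.2 hEbound)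
  -- The multiplier 0 isolates the regret; the multiplier `χ` below yields the violation.
  have hreg := hlag 0 ⟨le_rfl, hχ⟩
  rw [zero_mul, add_zero] at hreg
  refine ⟨hreg, ?_⟩
  have hL0 : 0 ≤ L := by linarith
  have hviol := M.violation_le_of_lagrangian hγ hH M.r_mem hstar hK (M.playedPolicy c ω)
    (by positivity) (hlag c.χ ⟨hχ, le_rfl⟩)
  refine hviol.trans ?_
  -- One factor `1 + 1 / γ` is traded away: `γ * (1 + 1 / γ) = γ + 1 ≤ 2 * H`, as the Slater
  -- condition forces `γ ≤ H`.
  have hfac : γ / H * (200 * (1 + 1 / γ) ^ 2) ≤ 400 * (1 + 1 / γ) := by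
    have e1 : γ / H * (200 * (1 + 1 / γ) ^ 2) = 200 * ((γ + 1) / H) * (1 + 1 / γ) := by
      field_simp
    have e2 : (γ + 1) / H ≤ 2 := by
      rw [div_le_iff₀ (by linarith)]
      linarith [hγ.le_horizon]
    rw [e1]
    have : 0 < 1 + 1 / γ := by positivity
    nlinarith
  calc γ / H * (200 * (1 + 1 / γ) ^ 2 * Fintype.card S
        * Real.sqrt (Fintype.card A * H ^ 5 * (H * K)) * L)
      = γ / H * (200 * (1 + 1 / γ) ^ 2) * (Fintype.card S
        * Real.sqrt (Fintype.card A * H ^ 5 * (H * K)) * L) := by ring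
    _ ≤ 400 * (1 + 1 / γ) * (Fintype.card S
        * Real.sqrt (Fintype.card A * H ^ 5 * (H * K)) * L) := by gcongr
    _ = _ := by ring

end TabularCMDP

theorem theorem2 :
    ∃ C₁ : ℝ, 0 < C₁ ∧ ∃ C : ℝ, 0 < C ∧ ∃ C' : ℝ, 0 < C' ∧
      ∀ (S : Type u) (A : Type v) [Fintype S] [Fintype A] [DecidableEq S] [DecidableEq A]
        [Nonempty A] (H K : ℕ) (_hK : 1 ≤ K) (M : TabularCMDP S A H)
        (γ : ℝ) (_hγ : M.Slater γ) (πstar : Policy S A) (_hstar : M.IsOptimal πstar)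
        (p : ℝ) (_hp : p ∈ Set.Ioo (0 : ℝ) 1) (T : ℝ) (_hT : T = H * K),
        ENNReal.ofReal (1 - p) ≤
          (M.runLaw (tabularParams C₁ (Fintype.card S) (Fintype.card A) H K γ p) K).toOuterMeasure
            {ω |
              M.regret (tabularParams C₁ (Fintype.card S) (Fintype.card A) H K γ p) πstar ω ≤
                  C * (1 + 1 / γ) ^ 2 * Fintype.card S * Real.sqrt (Fintype.card A * H ^ 5 * T)
                    * Real.log (Fintype.card S * Fintype.card A * T / p) ∧
              M.violation (tabularParams C₁ (Fintype.card S) (Fintype.card A) H K γ p) ω ≤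
                  C' * (1 + 1 / γ) * Fintype.card S * Real.sqrt (Fintype.card A * H ^ 5 * T)
                    * Real.log (Fintype.card S * Fintype.card A * T / p)} := by
  refine ⟨3, by norm_num, 200, by norm_num, 400, by norm_num, ?_⟩
  intro S A _ _ _ _ _ H K hK M γ hγ πstar hstar p hp T hT
  subst hT
  have hH := M.horizon_pos
  have hS : 1 ≤ Fintype.card S := Fintype.card_pos_iff.2 ⟨M.x₁⟩
  have hH' : (1 : ℝ) ≤ H := by exact_mod_cast hH
  have hK' : (1 : ℝ) ≤ K := by exact_mod_cast hK
  have hS' : (1 : ℝ) ≤ Fintype.card S := by exact_mod_cast hS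
  have hγ0 := hγ.1
  obtain ⟨hp0, hp1⟩ := hp
  rcases Nat.lt_or_ge (Fintype.card A) 2 with hA | hA
  -- With one action `log |A| = 0`, so `α = 0` and mirror descent does not apply; but there is only
  -- one policy, so the regret is zero and no violation occurs.
  · have : Subsingleton A := Fintype.card_le_one_iff_subsingleton.1 (by omega)
    have := PMF.subsingleton_of_subsingleton (α := A)
    have hπ : ∀ π π' : Policy S A, π = π' := fun π π' => Subsingleton.elim _ _
    have hA1 : (1 : ℝ) ≤ Fintype.card A := by exact_mod_cast Fintype.card_pos (α := A)
    have hL0 : 0 ≤ Real.log (Fintype.card S * Fintype.card A * (H * K) / p) := by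
      refine Real.log_nonneg ?_
      rw [le_div_iff₀ hp0]
      have : (1 : ℝ) * 1 * (1 * 1) ≤ Fintype.card S * Fintype.card A * (H * K) := by gcongr
      linarith
    refine PMF.ofReal_one_sub_le_toOuterMeasure _ _ (G := fun _ => 0) (fun _ => le_rfl)
      ((PMF.mean_const _ _).trans_le hp0.le) fun ω hω => (hω ⟨?_, ?_⟩).elim
    · refine le_trans (le_of_eq ?_) (by positivity)
      exact Finset.sum_eq_zero fun k _ => by rw [hπ πstar, sub_self]
    · refine le_trans (max_le ?_ le_rfl) (by positivity)
      refine Finset.sum_nonpos fun k _ => sub_nonpos.2 ?_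
      rw [hπ (M.playedPolicy _ ω k) πstar]
      exact hstar.1
  · obtain ⟨G, hG0, hGp, hG⟩ := M.exists_dominating hH
      (tabularParams 3 (Fintype.card S) (Fintype.card A) H K γ p)
      (mul_nonneg (mul_nonneg (by norm_num) (by linarith)) (Real.sqrt_nonneg _)) hK hp0
    refine PMF.ofReal_one_sub_le_toOuterMeasure _ _ hG0 hGp fun ω hω => ?_
    by_contra hlt
    obtain ⟨h1, h2⟩ := hG ω (not_le.1 hlt)
    exact hω (M.regret_and_violation_le hK hA hγ hstar ⟨hp0, hp1⟩ ω h1 h2)
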